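/- Let $p$ be a prime, $G$ a finite group, $N\unlhd G$ a normal subgroup, and $F$ a field of characteristic $p$ that is a splitting field for $G$ (every endomorphism of a simple $F[G]$-module is a scalar). Let $J=J(F[N])$ be the Jacobson radical of $F[N]$, let $F[G]J$ be the (two-sided) ideal of $F[G]$ generated by $J$, and let $I=r(J)=\{\alpha\in F[G] : J\alpha=0\}$, which is a two-sided ideal of $F[G]$. Let $P_1,\dots,P_l$ be representatives of the isomorphism classes of principal indecomposable right $F[G]$-modules. Let $S_1$ be the set of those $P_i$ whose head $\mathrm{Hd}(P_i)=P_i/\mathrm{rad}(P_i)$ is a $G/N$-module (that is, $N$ acts trivially on it), and let $S_2$ be the set of all other $P_i$. Let $c_{ij}$ be the Cartan numbers of $F[G]$, i.e. $c_{ij}$ is the multiplicity of $\mathrm{Hd}(P_j)$ as a composition factor of $P_i$. For a quotient algebra $B$ of $F[G]$, the Cartan matrix of $B$ is indexed by the same set $1,\dots,l$ as follows: if $\mathrm{Hd}(P_i)$ and $\mathrm{Hd}(P_j)$ are both $B$-modules, with projective $B$-covers $Q_i$ and $Q_j$, then its $(i,j)$ entry is the multiplicity of $\mathrm{Hd}(Q_j)$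 as a composition factor of $Q_i$; otherwise the entry is $0$. Let $\overline{c_{ij}}$, $x_{ij}$ and $a_{ij}$ be the entries so obtained for $B=F[G/N]$, $B=F[G]/I$ and $B=F[G]/F[G]J$, respectively. Then: 1. if $P_i,P_j\in S_1$, then $c_{ij}=\overline{c_{ij}}+x_{ij}$; 2. if $P_j\in S_1$ and $P_i\in S_2$, then $c_{ij}=x_{ij}$; 3. if $P_i,P_j\in S_2$, then $c_{ij}=a_{ij}+x_{ij}$. -/

import Mathlib

namespace CartanDecomp

/-! ### Modules: heads, composition multiplicities

Right modules over a ring `R` are modules over `Rᵐᵒᵖ`; `MulOpposite.op a • x` is `x · a`. -/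

section Modules

variable (S : Type*) [Ring S]

/-- The head `M / rad M` of a module, `rad M` being the intersection of its maximal submodules. -/
abbrev Head (M : Type*) [AddCommGroup M] [Module S M] : Type _ :=
  M ⧸ Module.jacobson S M

/-- A module is indecomposable if it is nonzero and is not the direct sum of two nonzero
submodules. -/
def IsIndecomposable (M : Type*) [AddCommGroup M] [Module S M] : Prop :=
  Nontrivial M ∧ ∀ U V : Submodule S M, IsCompl U V → U = ⊥ ∨ V = ⊥

variable {S} in
/-- The number of factors `s (i + 1) / s i` of a composition series `s` of submodules that are
isomorphic to `E`. -/
noncomputable def factorCount {M : Type*} [AddCommGroup M] [Module S M]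
    (s : CompositionSeries (Submodule S M)) (E : Type*) [AddCommGroup E] [Module S E] : ℕ :=
  Nat.card {i : Fin s.length //
    Nonempty ((s i.succ ⧸ (s i.castSucc).comap (s i.succ).subtype) ≃ₗ[S] E)}

open Classical in
/-- The multiplicity of `E` as a composition factor of a module `M` of finite length, computed in
any composition series of `M` (by convention `0` if `M` has no composition series). -/
noncomputable def compMultiplicity (M : Type*) [AddCommGroup M] [Module S M]
    (E : Type*) [AddCommGroup E] [Module S E] : ℕ :=
  if h : ∃ s : CompositionSeries (Submodule S M), s.head = ⊥ ∧ s.last = ⊤ then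
    factorCount h.choose E
  else 0

variable {S} in
/-- The number of factors isomorphic to `E` is the same in all composition series. -/
theorem factorCount_eq {M : Type*} [AddCommGroup M] [Module S M]
    (s t : CompositionSeries (Submodule S M)) (hb : s.head = t.head) (ht : s.last = t.last)
    (E : Type*) [AddCommGroup E] [Module S E] : factorCount s E = factorCount t E := by
  obtain ⟨f, hf⟩ := CompositionSeries.jordan_holder s t hb ht
  refine Nat.card_congr (f.subtypeEquiv fun i => ?_)
  have e := JordanHolderLattice.Iso.linearEquiv (hf i)
  exact ⟨fun ⟨g⟩ => ⟨e.symm.trans g⟩, fun ⟨g⟩ => ⟨e.trans g⟩⟩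

variable {S} in
/-- The multiplicity may be computed in an arbitrary composition series. -/
theorem compMultiplicity_eq {M : Type*} [AddCommGroup M] [Module S M]
    (s : CompositionSeries (Submodule S M)) (hb : s.head = ⊥) (ht : s.last = ⊤)
    (E : Type*) [AddCommGroup E] [Module S E] : compMultiplicity S M E = factorCount s E := by
  have h : ∃ s : CompositionSeries (Submodule S M), s.head = ⊥ ∧ s.last = ⊤ := ⟨s, hb, ht⟩
  rw [compMultiplicity, dif_pos h]
  exact factorCount_eq _ _ (h.choose_spec.1.trans hb.symm) (h.choose_spec.2.trans ht.symm) E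

end Modules

/-! ### Principal indecomposable modules and Cartan matrices -/

section Cartan

/-- `P` is a principal indecomposable right `R`-module: it is indecomposable and isomorphic to a
direct summand of the right regular module `R`. -/
def IsPIM (R : Type*) [Ring R] (P : Type*) [AddCommGroup P] [Module Rᵐᵒᵖ P] : Prop :=
  IsIndecomposable Rᵐᵒᵖ P ∧
    ∃ (i : P →ₗ[Rᵐᵒᵖ] R) (q : R →ₗ[Rᵐᵒᵖ] P), q ∘ₗ i = LinearMap.id

/-- The Cartan number of two principal indecomposable right `R`-modules `P`, `Q`: the multiplicity
of `Hd(Q)` as a composition factor of `P`. -/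
noncomputable def cartanNumber (R : Type*) [Ring R]
    (P : Type*) [AddCommGroup P] [Module Rᵐᵒᵖ P]
    (Q : Type*) [AddCommGroup Q] [Module Rᵐᵒᵖ Q] : ℕ :=
  compMultiplicity Rᵐᵒᵖ P (Head Rᵐᵒᵖ Q)

/-- The Cartan matrix of `R` with respect to a family of principal indecomposable modules. -/
noncomputable def cartanMatrix (R : Type*) [Ring R] {ι : Type*} (P : ι → Type*)
    [∀ i, AddCommGroup (P i)] [∀ i, Module Rᵐᵒᵖ (P i)] : Matrix ι ι ℕ :=
  Matrix.of fun i j => cartanNumber R (P i) (P j)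

/-- For a ring homomorphism `f : A → B`, a right `A`-module `P` and a right ideal `Q` of `B`:
`Q` is a principal indecomposable `B`-module whose head, regarded as an `A`-module through `f`, is
isomorphic to the head of `P`. When `f` is a surjection of finite-dimensional algebras and `P` is
principal indecomposable, this says that `Hd(P)` is a `B`-module and that `Q` is its projective
`B`-cover; such a `Q` is unique up to isomorphism. -/
def Corresponds {A B : Type*} [Ring A] [Ring B] (f : A →+* B)
    (P : Type*) [AddCommGroup P] [Module Aᵐᵒᵖ P] (Q : Submodule Bᵐᵒᵖ B) : Prop :=
  IsPIM B Q ∧ ∃ e : Head Aᵐᵒᵖ P ≃+ Head Bᵐᵒᵖ Q,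
    ∀ (a : A) (x : Head Aᵐᵒᵖ P), e (MulOpposite.op a • x) = MulOpposite.op (f a) • e x

open Classical in
/-- The Cartan matrix of a quotient algebra `B` of `A` (with quotient map `f`), indexed by the
principal indecomposable modules `P i` of `A`: if `Hd(P i)` and `Hd(P j)` are `B`-modules, with
projective `B`-covers `Q` and `Q'`, the `(i, j)` entry is the Cartan number of `B` at `Q`, `Q'`;
it is `0` if one of the two heads is not a `B`-module. -/
noncomputable def quotientCartanMatrix {A B : Type*} [Ring A] [Ring B] (f : A →+* B)
    {ι : Type*} (P : ι → Type*) [∀ i, AddCommGroup (P i)] [∀ i, Module Aᵐᵒᵖ (P i)] :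
    Matrix ι ι ℕ :=
  Matrix.of fun i j =>
    if h : ∃ Q : Submodule Bᵐᵒᵖ B × Submodule Bᵐᵒᵖ B,
        Corresponds f (P i) Q.1 ∧ Corresponds f (P j) Q.2 then
      cartanNumber B h.choose.1 h.choose.2
    else 0

end Cartan

/-! ### Group algebras -/

section GroupAlgebra

variable (F : Type*) [Field F] {G : Type*} [Group G] (N : Subgroup G)

/-- `F` is a splitting field for `G`: every endomorphism of a simple right `F[G]`-module is a
scalar. -/
def IsSplittingFieldFor.{u, v} (F : Type u) [Field F] (G : Type v) [Group G] : Prop :=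
  ∀ (E : Type (max u v)) [AddCommGroup E] [Module (MonoidAlgebra F G)ᵐᵒᵖ E]
    [IsSimpleModule (MonoidAlgebra F G)ᵐᵒᵖ E] (φ : Module.End (MonoidAlgebra F G)ᵐᵒᵖ E),
    ∃ c : F, ∀ x : E, φ x = MulOpposite.op (algebraMap F (MonoidAlgebra F G) c) • x

/-- The inclusion `F[N] → F[G]`. -/
noncomputable abbrev incl : MonoidAlgebra F N →+* MonoidAlgebra F G :=
  MonoidAlgebra.mapDomainRingHom F N.subtype

/-- The projection `F[G] → F[G/N]`. -/
noncomputable abbrev proj [N.Normal] : MonoidAlgebra F G →+* MonoidAlgebra F (G ⧸ N) :=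
  MonoidAlgebra.mapDomainRingHom F (QuotientGroup.mk' N)

/-- `N` acts trivially on the head of the right `F[G]`-module `P`, i.e. `Hd(P)` is a
`G/N`-module. -/
def HeadIsQuotientModule (P : Type*) [AddCommGroup P] [Module (MonoidAlgebra F G)ᵐᵒᵖ P] : Prop :=
  ∀ n ∈ N, ∀ x : Head (MonoidAlgebra F G)ᵐᵒᵖ P,
    MulOpposite.op (MonoidAlgebra.of F G n) • x = x

/-- The Jacobson radical of `F[N]` is stable under conjugation by `G`. -/
theorem exists_conj [N.Normal] (g : G) {β : MonoidAlgebra F N}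
    (hβ : β ∈ Ring.jacobson (MonoidAlgebra F N)) :
    ∃ γ ∈ Ring.jacobson (MonoidAlgebra F N),
      MonoidAlgebra.of F G g * incl F N γ = incl F N β * MonoidAlgebra.of F G g := by
  let σ : MonoidAlgebra F N ≃+* MonoidAlgebra F N :=
    MonoidAlgebra.mapDomainRingEquiv F (MulAut.conjNormal g⁻¹ : N ≃* N)
  have : RingHomSurjective (σ : MonoidAlgebra F N →+* MonoidAlgebra F N) := ⟨σ.surjective⟩
  refine ⟨σ β, Ring.le_comap_jacobson (σ : MonoidAlgebra F N →+* MonoidAlgebra F N) hβ, ?_⟩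
  clear hβ
  induction β using MonoidAlgebra.induction_on with
  | of n =>
    simp [σ, MonoidAlgebra.single_mul_single, mul_assoc]
  | add x y hx hy => rw [map_add, map_add, map_add, mul_add, add_mul, hx, hy]
  | smul r x hx =>
    have h1 : σ (r • x) = r • σ x :=
      map_smul (MonoidAlgebra.domCongr F F (MulAut.conjNormal g⁻¹ : N ≃* N)) r x
    have h2 : ∀ y : MonoidAlgebra F N, incl F N (r • y) = r • incl F N y :=
      fun y => map_smul (MonoidAlgebra.mapDomainAlgHom F F N.subtype) r y
    rw [h1, h2, h2, mul_smul_comm, smul_mul_assoc, hx]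

/-- The ideal `I = r(J) = {α ∈ F[G] | J α = 0}` of `F[G]`, where `J` is the Jacobson radical of
`F[N]`. -/
noncomputable def annJ [N.Normal] : Ideal (MonoidAlgebra F G) where
  carrier := {α | ∀ β ∈ Ring.jacobson (MonoidAlgebra F N), incl F N β * α = 0}
  zero_mem' := fun β _ => mul_zero _
  add_mem' := fun {a b} ha hb β hβ => by rw [mul_add, ha β hβ, hb β hβ, add_zero]
  smul_mem' := fun c α hα β hβ => by
    rw [smul_eq_mul]
    revert β
    induction c using MonoidAlgebra.induction_on with
    | of g =>
      intro β hβ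
      obtain ⟨γ, hγ, h⟩ := exists_conj F N g hβ
      rw [← mul_assoc, ← h, mul_assoc, hα γ hγ, mul_zero]
    | add x y hx hy => intro β hβ; rw [add_mul, mul_add, hx β hβ, hy β hβ, add_zero]
    | smul r x hx => intro β hβ; rw [smul_mul_assoc, mul_smul_comm, hx β hβ, smul_zero]

instance [N.Normal] : (annJ F N).IsTwoSided :=
  ⟨fun b ha β hβ => by rw [← mul_assoc, ha β hβ, zero_mul]⟩

/-- The ideal `F[G]J` of `F[G]` generated by the Jacobson radical `J` of `F[N]`. -/
noncomputable def idealJ : Ideal (MonoidAlgebra F G) :=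
  Ideal.span (incl F N '' (Ring.jacobson (MonoidAlgebra F N) : Set (MonoidAlgebra F N)))

instance [N.Normal] : (idealJ F N).IsTwoSided := by
  refine ⟨fun {a} b ha => ?_⟩
  induction b using MonoidAlgebra.induction_on with
  | of g =>
    refine Submodule.span_induction (p := fun x _ => x * MonoidAlgebra.of F G g ∈ idealJ F N)
      ?_ ?_ ?_ ?_ ha
    · rintro _ ⟨β, hβ, rfl⟩
      obtain ⟨γ, hγ, h⟩ := exists_conj F N g hβ
      rw [← h]
      exact Ideal.mul_mem_left _ _ (Ideal.subset_span ⟨γ, hγ, rfl⟩)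
    · rw [zero_mul]; exact zero_mem _
    · intro x y _ _ hx hy
      rw [add_mul]; exact add_mem hx hy
    · intro c x _ hx
      rw [smul_eq_mul, mul_assoc]; exact Ideal.mul_mem_left _ _ hx
  | add x y hx hy => rw [mul_add]; exact add_mem hx hy
  | smul r x hx =>
    rw [mul_smul_comm, Algebra.smul_def]; exact Ideal.mul_mem_left _ _ hx

end GroupAlgebra

end CartanDecomp

/-! Write A = F[G] and let K be the kernel of A → F[G/N]. The core is the identity c = a + x, valid
for all pairs of indices. For a surjection f from A onto B, the projective B-cover of Hd(P) is P /
P·ker f (`quotientCartanMatrix_apply`), so x counts factors of P / PI and a counts factors of P /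
PJ. It therefore suffices that PI ≅ P / PJ (`compMultiplicity_annJ`).

This isomorphism is multiplication by a central element z of A, supported on N, with annihilator AJ
and with zA = I. It is built from the sum χ of the characters of the simple k[N]-modules, k being
the prime field. Since k is finite, the radical of the form χ(uv) is exactly the Jacobson radical
(`exists_simpleTrace_ne_zero`), and this persists over F. The coefficient of az at g is χ of the
part of a on gN, whence az = 0 iff a ∈ AJ. Automorphisms of N permute the simple modules, so χ is
G-invariant and z is central. Finally A is a symmetric algebra, and duality between annihilators
turns ann(z) = AJ into zA = I (`mem_annJ_iff`).

It remains to compute a. Modulo its radical F[N] is semisimple, so its augmentation ideal has left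
and right identities there, and these serve K modulo AJ. If Hd(P_i) is a G/N-module then P_iK ≠ P_i,
and the left identity forces P_iK = P_iJ, so a and cbar agree in row i. Otherwise P_iK = P_i, the
right identity acts as 1 on P_i / P_iJ, no factor of it is killed by K, and a_ij = 0 for j in S₁. -/

namespace CartanDecomp

/-! ### Composition multiplicities under semilinear maps and extensions -/

section Multiplicity

variable {R S : Type*} [Ring R] [Ring S] {f : R →+* S}

/-- A semilinear surjection induces a semilinear bijection of quotients by corresponding
submodules. -/
theorem exists_bijective_quotient [RingHomSurjective f] {X Y : Type*} [AddCommGroup X] [Module R X]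
    [AddCommGroup Y] [Module S Y] (θ : X →ₛₗ[f] Y) (hθ : Function.Surjective θ)
    {p : Submodule R X} {q : Submodule S Y} (h : q.comap θ = p) :
    ∃ e : (X ⧸ p) →ₛₗ[f] (Y ⧸ q), Function.Bijective e ∧
      ∀ x, e (Submodule.Quotient.mk x) = Submodule.Quotient.mk (θ x) := by
  refine ⟨Submodule.mapQ p q θ h.ge, ⟨?_, ?_⟩, fun x => rfl⟩
  · rw [injective_iff_map_eq_zero]
    intro x
    induction x using Submodule.Quotient.induction_on with
    | _ x =>
      intro hx
      rw [Submodule.mapQ_apply, Submodule.Quotient.mk_eq_zero] at hx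
      rw [Submodule.Quotient.mk_eq_zero, ← h]
      exact hx
  · intro y
    induction y using Submodule.Quotient.induction_on with
    | _ y =>
      obtain ⟨x, rfl⟩ := hθ y
      exact ⟨Submodule.Quotient.mk x, rfl⟩

theorem nonempty_linearEquiv_iff (hf : Function.Surjective f) {X Y E E' : Type*}
    [AddCommGroup X] [Module R X] [AddCommGroup Y] [Module S Y]
    [AddCommGroup E] [Module R E] [AddCommGroup E'] [Module S E']
    (θ : X →ₛₗ[f] Y) (hθ : Function.Bijective θ)
    (β : E →ₛₗ[f] E') (hβ : Function.Bijective β) :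
    Nonempty (X ≃ₗ[R] E) ↔ Nonempty (Y ≃ₗ[S] E') := by
  let a : X ≃+ Y := AddEquiv.ofBijective θ.toAddMonoidHom hθ
  let b : E ≃+ E' := AddEquiv.ofBijective β.toAddMonoidHom hβ
  have ha : ∀ (r : R) x, a (r • x) = f r • a x := fun r x => θ.map_smulₛₗ r x
  have hb : ∀ (r : R) x, b (r • x) = f r • b x := fun r x => β.map_smulₛₗ r x
  constructor
  · rintro ⟨g⟩
    let k : Y ≃+ E' := (a.symm.trans g.toAddEquiv).trans b
    refine ⟨k.toLinearEquiv ?_⟩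
    intro s y
    obtain ⟨r, rfl⟩ := hf s
    obtain ⟨x, rfl⟩ := a.surjective y
    rw [← ha]
    simp [k, hb]
  · rintro ⟨g⟩
    let k : X ≃+ E := (a.trans g.toAddEquiv).trans b.symm
    refine ⟨k.toLinearEquiv ?_⟩
    intro r x
    apply b.injective
    rw [hb]
    simp [k, ha]

open Classical in
theorem factorCount_eq_sum {M : Type*} [AddCommGroup M] [Module S M]
    (s : CompositionSeries (Submodule S M)) (E : Type*) [AddCommGroup E] [Module S E] :
    factorCount s E = ∑ i : Fin s.length, if
      Nonempty ((s i.succ ⧸ (s i.castSucc).comap (s i.succ).subtype) ≃ₗ[S] E) then 1 else 0 := by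
  rw [factorCount, Nat.card_eq_fintype_card, Fintype.card_subtype, Finset.card_filter]

/-- Preimages under a surjection leave the factors unchanged up to semilinear bijection, so covering
steps remain covering steps. Semilinearity lets one lemma serve both the restriction of scalars from
B to A and the projection M → M / U. -/
theorem exists_compositionSeries_comap [RingHomSurjective f] {M M' E E' : Type*}
    [AddCommGroup M] [Module R M] [AddCommGroup M'] [Module S M']
    [AddCommGroup E] [Module R E] [AddCommGroup E'] [Module S E']
    (π : M →ₛₗ[f] M') (hπ : Function.Surjective π)
    (β : E →ₛₗ[f] E') (hβ : Function.Bijective β) (s : CompositionSeries (Submodule S M')) :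
    ∃ t : CompositionSeries (Submodule R M), t.head = s.head.comap π ∧ t.last = s.last.comap π ∧
      factorCount t E = factorCount s E' := by
  have key : ∀ a b : Submodule S M',
      ∃ e : (b.comap π ⧸ (a.comap π).comap (b.comap π).subtype) →ₛₗ[f]
        (b ⧸ a.comap b.subtype), Function.Bijective e := by
    intro a b
    let θ : b.comap π →ₛₗ[f] b := π.restrict (fun x hx => hx)
    have hθ : Function.Surjective θ := by
      rintro ⟨y, hy⟩
      obtain ⟨x, rfl⟩ := hπ y
      exact ⟨⟨x, hy⟩, rfl⟩
    obtain ⟨e, he, -⟩ := exists_bijective_quotient θ hθ (q := a.comap b.subtype)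
      (p := (a.comap π).comap (b.comap π).subtype) rfl
    exact ⟨e, he⟩
  let t : CompositionSeries (Submodule R M) :=
    { length := s.length
      toFun := fun i => (s i).comap π
      step := fun i => by
        have h : s i.castSucc ⋖ s i.succ := s.step i
        change (s i.castSucc).comap π ⋖ (s i.succ).comap π
        obtain ⟨e, he⟩ := key (s i.castSucc) (s i.succ)
        rw [covBy_iff_quot_is_simple (Submodule.comap_mono h.le),
          LinearMap.isSimpleModule_iff_of_bijective e he]
        exact (covBy_iff_quot_is_simple h.le).1 h }
  refine ⟨t, rfl, rfl, Nat.card_congr (Equiv.subtypeEquivRight fun i => ?_)⟩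
  obtain ⟨e, he⟩ := key (s i.castSucc) (s i.succ)
  exact nonempty_linearEquiv_iff RingHomSurjective.is_surjective e he β hβ

theorem exists_compositionSeries_map {M M' : Type*} (E : Type*)
    [AddCommGroup M] [Module R M] [AddCommGroup M'] [Module R M']
    [AddCommGroup E] [Module R E]
    (ι : M →ₗ[R] M') (hι : Function.Injective ι) (s : CompositionSeries (Submodule R M)) :
    ∃ t : CompositionSeries (Submodule R M'), t.head = s.head.map ι ∧ t.last = s.last.map ι ∧
      factorCount t E = factorCount s E := by
  have key : ∀ a b : Submodule R M,
      ∃ e : (b ⧸ a.comap b.subtype) →ₗ[R]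
        (b.map ι ⧸ (a.map ι).comap (b.map ι).subtype), Function.Bijective e := by
    intro a b
    obtain ⟨e, he, -⟩ := exists_bijective_quotient (ι.submoduleMap b)
      (ι.submoduleMap_surjective b) (p := a.comap b.subtype)
      (q := (a.map ι).comap (b.map ι).subtype) (by
        ext x
        simp only [Submodule.mem_comap, Submodule.subtype_apply, LinearMap.submoduleMap_coe_apply]
        exact ⟨fun ⟨y, hy, h⟩ => hι h ▸ hy, fun h => ⟨_, h, rfl⟩⟩)
    exact ⟨e, he⟩
  let t : CompositionSeries (Submodule R M') :=
    { length := s.length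
      toFun := fun i => (s i).map ι
      step := fun i => by
        have h : s i.castSucc ⋖ s i.succ := s.step i
        change (s i.castSucc).map ι ⋖ (s i.succ).map ι
        obtain ⟨e, he⟩ := key (s i.castSucc) (s i.succ)
        rw [covBy_iff_quot_is_simple (Submodule.map_mono h.le),
          ← LinearMap.isSimpleModule_iff_of_bijective e he]
        exact (covBy_iff_quot_is_simple h.le).1 h }
  refine ⟨t, rfl, rfl, Nat.card_congr (Equiv.subtypeEquivRight fun i => ?_)⟩
  obtain ⟨e, he⟩ := key (s i.castSucc) (s i.succ)
  exact (nonempty_linearEquiv_iff (f := RingHom.id R) Function.surjective_id e he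
    (LinearMap.id : E →ₗ[R] E) Function.bijective_id).symm

/-- Multiplicities are invariant under bijections that are semilinear over a surjective ring
homomorphism. -/
theorem compMultiplicity_congr [RingHomSurjective f] {M M' E E' : Type*}
    [AddCommGroup M] [Module R M] [AddCommGroup M'] [Module S M']
    [AddCommGroup E] [Module R E] [AddCommGroup E'] [Module S E']
    [IsNoetherian S M'] [IsArtinian S M']
    (π : M →ₛₗ[f] M') (hπ : Function.Bijective π) (β : E →ₛₗ[f] E') (hβ : Function.Bijective β) :
    compMultiplicity R M E = compMultiplicity S M' E' := by
  obtain ⟨s, hs, hs'⟩ := exists_compositionSeries_of_isNoetherian_isArtinian S M'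
  obtain ⟨t, ht, ht', h⟩ := exists_compositionSeries_comap π hπ.2 β hβ s
  rw [compMultiplicity_eq s hs hs', compMultiplicity_eq t _ _, h]
  · rw [ht, hs, Submodule.comap_bot, LinearMap.ker_eq_bot.2 hπ.1]
  · rw [ht', hs', Submodule.comap_top]

/-- Multiplicities are additive on short exact sequences. -/
theorem compMultiplicity_add_quotient {M : Type*} (E : Type*) [AddCommGroup M] [Module R M]
    [AddCommGroup E] [Module R E] [IsNoetherian R M] [IsArtinian R M] (U : Submodule R M) :
    compMultiplicity R M E = compMultiplicity R U E + compMultiplicity R (M ⧸ U) E := by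
  classical
  obtain ⟨s, hs, hs'⟩ := exists_compositionSeries_of_isNoetherian_isArtinian R U
  obtain ⟨t, ht, ht'⟩ := exists_compositionSeries_of_isNoetherian_isArtinian R (M ⧸ U)
  obtain ⟨s₁, h1, h2, h3⟩ := exists_compositionSeries_map E U.subtype U.injective_subtype s
  obtain ⟨t₁, h4, h5, h6⟩ := exists_compositionSeries_comap U.mkQ U.mkQ_surjective
    (LinearMap.id : E →ₗ[R] E) Function.bijective_id t
  -- The series of U, pushed into M, ends at U, where the pulled-back series of M / U begins.
  have hc : s₁.last = t₁.head := by
    rw [h2, h4, hs', ht, Submodule.comap_bot, Submodule.ker_mkQ, Submodule.map_subtype_top]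
  rw [compMultiplicity_eq s hs hs', compMultiplicity_eq t ht ht', ← h3, ← h6,
    compMultiplicity_eq (RelSeries.smash s₁ t₁ hc) (by rw [RelSeries.head_smash, h1, hs]; simp)
      (by rw [RelSeries.last_smash, h5, ht']; simp)]
  rw [factorCount_eq_sum, factorCount_eq_sum, factorCount_eq_sum]
  let φ : Submodule R M → Submodule R M → ℕ := fun a b =>
    if Nonempty ((b ⧸ a.comap b.subtype) ≃ₗ[R] E) then 1 else 0
  refine (Fin.sum_univ_add (a := s₁.length) (b := t₁.length) _).trans ?_
  congr 1
  · exact Finset.sum_congr rfl fun i _ =>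
      congrArg₂ φ (RelSeries.smash_castAdd hc i) (RelSeries.smash_succ_castAdd hc i)
  · exact Finset.sum_congr rfl fun i _ =>
      congrArg₂ φ (RelSeries.smash_natAdd hc i) (RelSeries.smash_succ_natAdd hc i)

/-- A module occurring with nonzero multiplicity is isomorphic to a simple subquotient. -/
theorem exists_of_compMultiplicity_ne_zero {M : Type*} {E : Type*} [AddCommGroup M] [Module R M]
    [AddCommGroup E] [Module R E] (h : compMultiplicity R M E ≠ 0) :
    ∃ a b : Submodule R M, a ⋖ b ∧ Nonempty ((b ⧸ a.comap b.subtype) ≃ₗ[R] E) := by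
  rw [compMultiplicity] at h
  split_ifs at h with hs
  · have : Nonempty _ := (Nat.card_ne_zero.1 h).1
    obtain ⟨i, hi⟩ := this
    exact ⟨_, _, hs.choose.step i, hi⟩
  · exact absurd rfl h

end Multiplicity

end CartanDecomp

/-! ### Fitting's lemma and hollow modules -/

namespace CartanDecomp

section Hollow

variable {R : Type*} [Ring R] {M : Type*} [AddCommGroup M] [Module R M]

/-- An endomorphism of an indecomposable module of finite length is bijective or nilpotent. -/
theorem IsIndecomposable.bijective_or_isNilpotent [IsNoetherian R M] [IsArtinian R M]
    (hM : IsIndecomposable R M) (φ : Module.End R M) : Function.Bijective φ ∨ IsNilpotent φ := by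
  -- Fitting decomposition; n ≥ 1 is needed for ker φ ≤ ker φ ^ n.
  obtain ⟨n, hn, hpos⟩ := (φ.eventually_isCompl_ker_pow_range_pow.and
    (Filter.eventually_ge_atTop 1)).exists
  rcases hM.2 _ _ hn with h | h
  · left
    have h1 : Function.Injective φ := by
      rw [← LinearMap.ker_eq_bot, eq_bot_iff, ← h]
      intro x hx
      obtain ⟨m, rfl⟩ := Nat.exists_eq_add_of_le' hpos
      rw [LinearMap.mem_ker, pow_succ, Module.End.mul_apply, LinearMap.mem_ker.1 hx, map_zero]
    exact IsArtinian.bijective_of_injective_endomorphism φ h1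
  · right
    exact ⟨n, LinearMap.range_eq_bot.1 h⟩

/-- A module is hollow if two proper submodules never span it. -/
def IsHollow (R M : Type*) [Ring R] [AddCommGroup M] [Module R M] : Prop :=
  ∀ U V : Submodule R M, U ⊔ V = ⊤ → U = ⊤ ∨ V = ⊤

theorem IsHollow.le_jacobson (hM : IsHollow R M) {U : Submodule R M} (hU : U ≠ ⊤) :
    U ≤ Module.jacobson R M := by
  refine le_sInf fun W hW => ?_
  by_contra h
  have h1 : W ⊔ U = ⊤ := hW.2 _ (left_lt_sup.2 h)
  rcases hM _ _ h1 with h2 | h2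
  · exact hW.1 h2
  · exact hU h2

theorem IsHollow.of_surjective {S : Type*} [Ring S] {f : R →+* S} [RingHomSurjective f]
    {M' : Type*} [AddCommGroup M'] [Module S M'] (hM : IsHollow R M) (π : M →ₛₗ[f] M')
    (hπ : Function.Surjective π) : IsHollow S M' := by
  intro U V h
  have key : ∀ W : Submodule S M', W.comap π = ⊤ → W = ⊤ := fun W hW =>
    Submodule.comap_injective_of_surjective hπ (hW.trans (Submodule.comap_top π).symm)
  refine (hM (U.comap π) (V.comap π) ?_).imp (key U) (key V)
  rw [eq_top_iff]
  intro x _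
  obtain ⟨u, hu, v, hv, huv⟩ := Submodule.mem_sup.1 (h ▸ Submodule.mem_top : π x ∈ U ⊔ V)
  obtain ⟨y, rfl⟩ := hπ u
  refine Submodule.mem_sup.2 ⟨y, hu, x - y, ?_, by abel⟩
  rw [Submodule.mem_comap, map_sub, ← huv, add_sub_cancel_left]
  exact hv

theorem IsHollow.isIndecomposable [Nontrivial M] (hM : IsHollow R M) : IsIndecomposable R M := by
  refine ⟨inferInstance, fun U V h => ?_⟩
  rcases hM U V h.sup_eq_top with h1 | h1
  · right
    rw [eq_bot_iff, ← h.inf_eq_bot, h1, top_inf_eq]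
  · left
    rw [eq_bot_iff, ← h.inf_eq_bot, h1, inf_top_eq]

end Hollow

/-! ### Principal indecomposable modules and projective covers over quotient rings -/

section PIM

open MulOpposite

variable {A : Type*} [Ring A] {P : Type*} [AddCommGroup P] [Module Aᵐᵒᵖ P]

/-- For a set `K` of ring elements, the submodule `P K` of the right module `P`. -/
def rightSMul (K : Set A) (P : Type*) [AddCommGroup P] [Module Aᵐᵒᵖ P] : Submodule Aᵐᵒᵖ P :=
  Submodule.span Aᵐᵒᵖ {y | ∃ k ∈ K, ∃ x : P, y = op k • x}

theorem op_smul_mem_rightSMul {K : Set A} {k : A} (hk : k ∈ K) (x : P) :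
    op k • x ∈ rightSMul K P :=
  Submodule.subset_span ⟨k, hk, x, rfl⟩

theorem op_smul_quotient_rightSMul {K : Set A} {k : A} (hk : k ∈ K) (x : P ⧸ rightSMul K P) :
    op k • x = 0 := by
  induction x using Submodule.Quotient.induction_on with
  | _ x =>
    rw [← Submodule.Quotient.mk_smul, Submodule.Quotient.mk_eq_zero]
    exact op_smul_mem_rightSMul hk x

theorem op_smul_map_one {i : P →ₗ[Aᵐᵒᵖ] A} {q : A →ₗ[Aᵐᵒᵖ] P} (h : q ∘ₗ i = LinearMap.id) (x : P) :
    op (i x) • q 1 = x := by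
  rw [← map_smul, op_smul_eq_mul, one_mul]
  exact LinearMap.congr_fun h x

instance : Module.Finite Aᵐᵒᵖ A :=
  Module.Finite.of_surjective (LinearMap.toSpanSingleton Aᵐᵒᵖ A 1)
    fun a => ⟨op a, by simp⟩

theorem IsPIM.finite (hP : IsPIM A P) : Module.Finite Aᵐᵒᵖ P := by
  obtain ⟨-, i, q, h⟩ := hP
  exact Module.Finite.of_surjective q fun x => ⟨i x, LinearMap.congr_fun h x⟩

theorem IsPIM.jacobson_ne_top (hP : IsPIM A P) : Module.jacobson Aᵐᵒᵖ P ≠ ⊤ := by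
  have := hP.finite
  have := hP.1.1
  exact (Module.jacobson_lt_top Aᵐᵒᵖ P).ne

theorem IsPIM.nontrivial_head (hP : IsPIM A P) : Nontrivial (Head Aᵐᵒᵖ P) :=
  Submodule.Quotient.nontrivial_iff.2 hP.jacobson_ne_top

/-- The element q 1 generates P and x = (q 1) · i x. Splitting q 1 = u + v along U + V = P splits
the identity into the endomorphisms x ↦ u · i x and x ↦ v · i x, with images in U and V. By Fitting
one of them is bijective: if the first is nilpotent, the second is 1 minus a nilpotent. -/
theorem IsPIM.isHollow [IsArtinianRing Aᵐᵒᵖ] (hP : IsPIM A P) : IsHollow Aᵐᵒᵖ P := by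
  have := hP.finite
  obtain ⟨hP, i, q, h⟩ := hP
  intro U V hUV
  obtain ⟨u, hu, v, hv, huv⟩ := Submodule.mem_sup.1 (hUV ▸ Submodule.mem_top : q 1 ∈ U ⊔ V)
  let m : P → P →ₗ[Aᵐᵒᵖ] P := fun w =>
    { toFun := fun x => op (i x) • w
      map_add' := fun x y => by rw [map_add, op_add, add_smul]
      map_smul' := fun a x => by
        rw [map_smul, RingHom.id_apply, smul_smul, ← op_unop a, op_smul_eq_mul, op_mul] }
  have hsum : m u + m v = 1 := by
    ext x
    change op (i x) • u + op (i x) • v = x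
    rw [← smul_add, huv, op_smul_map_one h]
  have hrange : ∀ (W : Submodule Aᵐᵒᵖ P) (w : P), w ∈ W → Function.Bijective (m w) → W = ⊤ := by
    intro W w hw hb
    rw [eq_top_iff]
    intro x _
    obtain ⟨y, rfl⟩ := hb.2 x
    exact W.smul_mem _ hw
  rcases hP.bijective_or_isNilpotent (m u) with h1 | h1
  · exact Or.inl (hrange U u hu h1)
  · refine Or.inr (hrange V v hv ?_)
    rw [← Module.End.isUnit_iff, eq_sub_of_add_eq' hsum]
    exact h1.isUnit_one_sub

variable {B : Type*} [Ring B] (f : A →+* B)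

theorem op_surjective {f : A →+* B} (hf : Function.Surjective f) :
    Function.Surjective (RingHom.op f) := fun b => by
  obtain ⟨a, ha⟩ := hf b.unop
  exact ⟨op a, by simp [ha]⟩

/-- Lifting an isomorphism of heads to a semilinear map out of a principal indecomposable
module. -/
theorem IsPIM.exists_lift {Q : Type*} [AddCommGroup Q] [Module Bᵐᵒᵖ Q] [IsArtinianRing Bᵐᵒᵖ]
    (hf : Function.Surjective f)
    (hP : IsPIM A P) (hQ : IsPIM B Q) (e : Head Aᵐᵒᵖ P ≃+ Head Bᵐᵒᵖ Q)
    (he : ∀ (a : A) (x : Head Aᵐᵒᵖ P), e (op a • x) = op (f a) • e x) :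
    ∃ π : P →ₛₗ[RingHom.op f] Q, Function.Surjective π := by
  obtain ⟨-, i, q, h⟩ := hP
  obtain ⟨y, hy⟩ := Submodule.Quotient.mk_surjective _ (e (Submodule.Quotient.mk (q 1)))
  -- Projectivity made explicit: q 1 is sent to a lift y of its image in the head of Q. The image of
  -- π together with rad Q is Q, so hollowness of Q makes π surjective.
  let π : P →ₛₗ[RingHom.op f] Q :=
    { toFun := fun x => op (f (i x)) • y
      map_add' := fun x y => by rw [map_add, map_add, op_add, add_smul]
      map_smul' := fun a x => by
        rw [map_smul, smul_smul, ← op_unop a, op_smul_eq_mul, map_mul, op_mul]; rfl }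
  have hmk : ∀ x, (Submodule.Quotient.mk (π x) : Head Bᵐᵒᵖ Q) = e (Submodule.Quotient.mk x) := by
    intro x
    change Submodule.Quotient.mk (op (f (i x)) • y) = _
    rw [Submodule.Quotient.mk_smul, hy, ← he, ← Submodule.Quotient.mk_smul, op_smul_map_one h]
  have : RingHomSurjective (RingHom.op f) := ⟨op_surjective hf⟩
  refine ⟨π, LinearMap.range_eq_top.1 ?_⟩
  refine (hQ.isHollow (LinearMap.range π) (Module.jacobson Bᵐᵒᵖ Q) ?_).resolve_right
    hQ.jacobson_ne_top
  rw [eq_top_iff]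
  intro z _
  obtain ⟨w, hw⟩ := e.surjective (Submodule.Quotient.mk z)
  induction w using Submodule.Quotient.induction_on with
  | _ x =>
    refine Submodule.mem_sup.2 ⟨π x, ⟨x, rfl⟩, z - π x, ?_, by abel⟩
    rw [← Submodule.Quotient.eq, hmk, hw]

/-- Principal indecomposable modules with isomorphic heads are isomorphic. -/
theorem IsPIM.nonempty_linearEquiv [IsArtinianRing Aᵐᵒᵖ] {Q : Type*} [AddCommGroup Q]
    [Module Aᵐᵒᵖ Q] (hP : IsPIM A P) (hQ : IsPIM A Q)
    (e : Head Aᵐᵒᵖ P ≃ₗ[Aᵐᵒᵖ] Head Aᵐᵒᵖ Q) : Nonempty (P ≃ₗ[Aᵐᵒᵖ] Q) := by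
  obtain ⟨π, hπ⟩ := hP.exists_lift (RingHom.id A) Function.surjective_id hQ e.toAddEquiv
    (fun a x => e.map_smul _ x)
  obtain ⟨ρ, hρ⟩ := hQ.exists_lift (RingHom.id A) Function.surjective_id hP e.symm.toAddEquiv
    (fun a x => e.symm.map_smul _ x)
  let π' : P →ₗ[Aᵐᵒᵖ] Q := { π with map_smul' := fun a x => π.map_smulₛₗ a x }
  let ρ' : Q →ₗ[Aᵐᵒᵖ] P := { ρ with map_smul' := fun a x => ρ.map_smulₛₗ a x }
  have := hP.finite
  have h : Function.Injective (ρ' ∘ₗ π') :=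
    IsNoetherian.injective_of_surjective_endomorphism _ (hρ.comp hπ)
  exact ⟨LinearEquiv.ofBijective π' ⟨Function.Injective.of_comp h, hπ⟩⟩

theorem exists_head_equiv {f : A →+* B} (hf : Function.Surjective f) {Q : Type*} [AddCommGroup Q]
    [Module Bᵐᵒᵖ Q] (π : P →ₛₗ[RingHom.op f] Q) (hπ : Function.Surjective π)
    (hker : LinearMap.ker π ≤ Module.jacobson Aᵐᵒᵖ P) :
    ∃ e : Head Aᵐᵒᵖ P ≃+ Head Bᵐᵒᵖ Q,
      ∀ (a : A) (x : Head Aᵐᵒᵖ P), e (op a • x) = op (f a) • e x := by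
  have : RingHomSurjective (RingHom.op f) := ⟨op_surjective hf⟩
  obtain ⟨e, he, -⟩ := exists_bijective_quotient π hπ (Module.comap_jacobson_of_ker_le hπ hker)
  exact ⟨AddEquiv.ofBijective e.toAddMonoidHom he, fun a x => e.map_smulₛₗ (op a) x⟩

/-- The `B`-module `P / P (ker f)` realised as a principal indecomposable right ideal of `B`. -/
theorem IsPIM.exists_corresponds [IsArtinianRing Aᵐᵒᵖ] (hf : Function.Surjective f)
    (hP : IsPIM A P) (hK : rightSMul (RingHom.ker f : Set A) P ≠ ⊤) :
    ∃ Q : Submodule Bᵐᵒᵖ B, Corresponds f P Q ∧ ∃ π : P →ₛₗ[RingHom.op f] Q,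
      Function.Surjective π ∧ LinearMap.ker π = rightSMul (RingHom.ker f : Set A) P := by
  have hhol := hP.isHollow
  obtain ⟨-, i, q, h⟩ := hP
  have : RingHomSurjective (RingHom.op f) := ⟨op_surjective hf⟩
  -- This u is idempotent and P ≅ uA; the cover over B is f(u)B.
  let u := i (q 1)
  have hi : ∀ x, u * i x = i x := fun x => by
    conv_rhs => rw [← op_smul_map_one h x, map_smul, op_smul_eq_mul]
  let L : B →ₗ[Bᵐᵒᵖ] B :=
    { toFun := fun b => f u * b
      map_add' := fun x y => mul_add _ x y
      map_smul' := fun a x => by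
        rw [RingHom.id_apply, ← op_unop a, op_smul_eq_mul, op_smul_eq_mul, mul_assoc] }
  have hL : ∀ b, L b = f u * b := fun b => rfl
  let Q := LinearMap.range L
  let π : P →ₛₗ[RingHom.op f] Q :=
    { toFun := fun x => ⟨f (i x), ⟨f (i x), by rw [hL, ← map_mul, hi]⟩⟩
      map_add' := fun x y => Subtype.ext (by simp)
      map_smul' := fun a x => Subtype.ext (by
        change f (i (a • x)) = f (i x) * f a.unop
        rw [map_smul, ← map_mul]; rfl) }
  have hπ : Function.Surjective π := by
    rintro ⟨_, b, rfl⟩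
    obtain ⟨a, rfl⟩ := hf b
    refine ⟨op a • q 1, Subtype.ext ?_⟩
    change f (i (op a • q 1)) = f u * f a
    rw [map_smul, op_smul_eq_mul, map_mul]
  have hker : LinearMap.ker π = rightSMul (RingHom.ker f : Set A) P := by
    apply le_antisymm
    · intro x hx
      have hx' : f (i x) = 0 := congrArg Subtype.val (LinearMap.mem_ker.1 hx)
      rw [← op_smul_map_one h x]
      exact op_smul_mem_rightSMul (RingHom.mem_ker.2 hx') _
    · refine Submodule.span_le.2 ?_
      rintro _ ⟨k, hk, x, rfl⟩
      refine LinearMap.mem_ker.2 (Subtype.ext ?_)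
      change f (i (op k • x)) = 0
      rw [map_smul, op_smul_eq_mul, map_mul, (RingHom.mem_ker).1 hk, mul_zero]
  have hnt : Nontrivial Q := by
    by_contra hn
    rw [not_nontrivial_iff_subsingleton] at hn
    refine hK (hker ▸ eq_top_iff.2 fun x _ => ?_)
    exact Subsingleton.elim _ _
  refine ⟨Q, ⟨⟨(hhol.of_surjective π hπ).isIndecomposable, Q.subtype,
    L.codRestrict Q fun b => ⟨b, rfl⟩, ?_⟩, ?_⟩, π, hπ, hker⟩
  · ext x
    obtain ⟨_, b, rfl⟩ := x
    change f u * (f u * b) = f u * b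
    rw [← mul_assoc, ← map_mul, hi]
  · exact exists_head_equiv hf π hπ (hker ▸ hhol.le_jacobson hK)

theorem Corresponds.rightSMul_ne_top {f : A →+* B} {Q : Submodule Bᵐᵒᵖ B} (hP : IsPIM A P)
    (h : Corresponds f P Q) : rightSMul (RingHom.ker f : Set A) P ≠ ⊤ := by
  obtain ⟨-, e, he⟩ := h
  intro htop
  refine hP.jacobson_ne_top (eq_top_iff.2 (htop ▸ Submodule.span_le.2 ?_))
  rintro _ ⟨k, hk, x, rfl⟩
  rw [SetLike.mem_coe, ← Submodule.Quotient.mk_eq_zero]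
  apply e.injective
  rw [Submodule.Quotient.mk_smul, he, (RingHom.mem_ker).1 hk, op_zero, zero_smul, map_zero]

/-- An arbitrary Q is known only through its head; it is isomorphic to the explicit cover because
the head determines a principal indecomposable module. -/
theorem Corresponds.exists_surjective [IsArtinianRing Aᵐᵒᵖ] [IsArtinianRing Bᵐᵒᵖ] {f : A →+* B}
    (hf : Function.Surjective f) {Q : Submodule Bᵐᵒᵖ B} (hP : IsPIM A P)
    (h : Corresponds f P Q) :
    ∃ π : P →ₛₗ[RingHom.op f] Q,
      Function.Surjective π ∧ LinearMap.ker π = rightSMul (RingHom.ker f : Set A) P := by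
  obtain ⟨Q', h', π, hπ, hker⟩ := hP.exists_corresponds f hf (h.rightSMul_ne_top hP)
  obtain ⟨hQ, e, he⟩ := h
  obtain ⟨hQ', e', he'⟩ := h'
  let g : Head Bᵐᵒᵖ Q' ≃ₗ[Bᵐᵒᵖ] Head Bᵐᵒᵖ Q := (e'.symm.trans e).toLinearEquiv fun b x => by
    obtain ⟨a, ha⟩ := hf b.unop
    obtain ⟨y, rfl⟩ := e'.surjective x
    rw [← op_unop b, ← ha, ← he']
    simp [he]
  obtain ⟨k⟩ := hQ'.nonempty_linearEquiv hQ g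
  refine ⟨{ toFun := fun x => k (π x)
            map_add' := fun x y => by rw [map_add, map_add]
            map_smul' := fun a x => by rw [π.map_smulₛₗ, map_smul] },
    k.surjective.comp hπ, ?_⟩
  rw [← hker]
  ext x
  exact k.map_eq_zero_iff

/-- The entries of the Cartan matrix of a quotient algebra are multiplicities in the quotients
`P i / (P i) (ker f)`. -/
theorem quotientCartanMatrix_apply [IsArtinianRing Aᵐᵒᵖ] (hf : Function.Surjective f)
    {ι : Type*} (P : ι → Type*) [∀ i, AddCommGroup (P i)] [∀ i, Module Aᵐᵒᵖ (P i)]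
    (hP : ∀ i, IsPIM A (P i)) (i j : ι) :
    quotientCartanMatrix f P i j =
      compMultiplicity Aᵐᵒᵖ (P i ⧸ rightSMul (RingHom.ker f : Set A) (P i)) (Head Aᵐᵒᵖ (P j)) := by
  have : RingHomSurjective (RingHom.op f) := ⟨op_surjective hf⟩
  have : IsArtinianRing Bᵐᵒᵖ := (op_surjective hf).isArtinianRing
  rw [quotientCartanMatrix, Matrix.of_apply]
  split_ifs with h
  · obtain ⟨h1, h2⟩ := h.choose_spec
    obtain ⟨π, hπ, hker⟩ := h1.exists_surjective hf (hP i)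
    obtain ⟨hQ, e, he⟩ := h2
    have := h1.1.finite
    obtain ⟨π', hπ', -⟩ := exists_bijective_quotient π hπ (q := ⊥)
      ((Submodule.comap_bot π).trans hker)
    let k := Submodule.quotEquivOfEqBot (⊥ : Submodule Bᵐᵒᵖ h.choose.1) rfl
    let π'' : (P i ⧸ rightSMul (RingHom.ker f : Set A) (P i)) →ₛₗ[RingHom.op f] h.choose.1 :=
      { toFun := fun x => k (π' x)
        map_add' := fun x y => by rw [map_add, map_add]
        map_smul' := fun a x => by rw [π'.map_smulₛₗ, map_smul] }
    let β : Head Aᵐᵒᵖ (P j) →ₛₗ[RingHom.op f] Head Bᵐᵒᵖ h.choose.2 :=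
      { toFun := e
        map_add' := e.map_add
        map_smul' := fun a x => he a.unop x }
    exact (compMultiplicity_congr π'' (k.bijective.comp hπ') β e.bijective).symm
  -- The default entry 0 is the right value: if Hd(P j) is a factor of P i / (P i)(ker f), then ker
  -- f kills Hd(P j) and the quotient is nonzero, so both heads have B-covers.
  · by_contra hne
    obtain ⟨a, b, -, ⟨g⟩⟩ := exists_of_compMultiplicity_ne_zero (Ne.symm hne)
    have hkill : ∀ k ∈ (RingHom.ker f : Set A), ∀ x : Head Aᵐᵒᵖ (P j), op k • x = 0 := by
      intro k hk x
      obtain ⟨y, rfl⟩ := g.surjective x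
      rw [← map_smul]
      refine (congrArg g ?_).trans (map_zero g)
      induction y using Submodule.Quotient.induction_on with
      | _ y =>
        rw [← Submodule.Quotient.mk_smul, Submodule.Quotient.mk_eq_zero]
        have : op k • y = 0 := Subtype.ext (op_smul_quotient_rightSMul hk y.1)
        exact this ▸ zero_mem _
    have hj : rightSMul (RingHom.ker f : Set A) (P j) ≠ ⊤ := by
      intro htop
      refine (hP j).jacobson_ne_top (eq_top_iff.2 (htop ▸ Submodule.span_le.2 ?_))
      rintro _ ⟨k, hk, x, rfl⟩
      rw [SetLike.mem_coe, ← Submodule.Quotient.mk_eq_zero, Submodule.Quotient.mk_smul]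
      exact hkill k hk _
    have hi : rightSMul (RingHom.ker f : Set A) (P i) ≠ ⊤ := by
      intro htop
      have hn := (hP j).nontrivial_head
      have : Subsingleton (P i ⧸ rightSMul (RingHom.ker f : Set A) (P i)) :=
        Submodule.Quotient.subsingleton_iff.2 htop
      have : Subsingleton (Head Aᵐᵒᵖ (P j)) := g.symm.injective.subsingleton
      exact not_subsingleton _ this
    obtain ⟨Q, hQ, -⟩ := (hP i).exists_corresponds f hf hi
    obtain ⟨Q', hQ', -⟩ := (hP j).exists_corresponds f hf hj
    exact h ⟨(Q, Q'), hQ, hQ'⟩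

end PIM

end CartanDecomp

/-! ### Trace form of a finite algebra and its radical -/

namespace CartanDecomp

section SimpleTrace

variable (k R : Type*) [Field k] [Ring R] [Algebra k R]

/-- The trace of the action of the elements of an algebra on a module. -/
noncomputable def actionTrace (M : Type*) [AddCommGroup M] [Module k M] [Module R M]
    [IsScalarTower k R M] : R →ₗ[k] k :=
  LinearMap.trace k M ∘ₗ (Algebra.lsmul k k M : R →ₐ[k] Module.End k M).toLinearMap

theorem actionTrace_apply (M : Type*) [AddCommGroup M] [Module k M] [Module R M]
    [IsScalarTower k R M] (x : R) :
    actionTrace k R M x = LinearMap.trace k M (Algebra.lsmul k k M x) := rfl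

variable {k R} in
theorem actionTrace_congr {M M' : Type*} [AddCommGroup M] [Module k M] [Module R M]
    [IsScalarTower k R M] [AddCommGroup M'] [Module k M'] [Module R M'] [IsScalarTower k R M']
    (e : M ≃ₗ[k] M') (x y : R) (h : ∀ m, e (x • m) = y • e m) :
    actionTrace k R M x = actionTrace k R M' y := by
  rw [actionTrace_apply, actionTrace_apply, ← LinearMap.trace_conj' _ e]
  congr 1
  ext m
  obtain ⟨m, rfl⟩ := e.surjective m
  simp [LinearEquiv.conj_apply, h]

/-- Two maximal left ideals are equivalent if they have isomorphic simple quotients. -/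
def simpleSetoid : Setoid {m : Ideal R // m.IsMaximal} where
  r m m' := Nonempty ((R ⧸ m.1) ≃ₗ[R] (R ⧸ m'.1))
  iseqv :=
    { refl := fun _ => ⟨LinearEquiv.refl _ _⟩
      symm := fun ⟨e⟩ => ⟨e.symm⟩
      trans := fun ⟨e⟩ ⟨e'⟩ => ⟨e.trans e'⟩ }

variable {R} in
/-- The trace on a simple module, as a function of its isomorphism class. -/
noncomputable def classTrace (c : Quotient (simpleSetoid R)) : R →ₗ[k] k :=
  Quotient.lift (s := simpleSetoid R) (fun m => actionTrace k R (R ⧸ m.1)) (fun m m' h => by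
    obtain ⟨e⟩ : Nonempty ((R ⧸ m.1) ≃ₗ[R] (R ⧸ m'.1)) := h
    exact LinearMap.ext fun x =>
      actionTrace_congr (e.restrictScalars k) x x fun m => e.map_smul x m) c

/-- The sum of the traces on the simple modules, one for each isomorphism class. -/
noncomputable def simpleTrace : R →ₗ[k] k :=
  ∑ᶠ c : Quotient (simpleSetoid R), classTrace k c

instance [Finite R] : Finite (Quotient (simpleSetoid R)) := by
  have : Finite (Ideal R) := Finite.of_injective (fun I : Ideal R => (I : Set R)) SetLike.coe_injective
  infer_instance

theorem simpleTrace_apply [Fintype (Quotient (simpleSetoid R))] (x : R) :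
    simpleTrace k R x = ∑ c : Quotient (simpleSetoid R), classTrace k c x := by
  rw [simpleTrace, finsum_eq_sum_of_fintype, LinearMap.sum_apply]

variable {k R}

theorem exists_bijective_quotient_comap (σ : R ≃+* R) (m : Ideal R) :
    ∃ e : (R ⧸ m.comap (σ : R →+* R)) →ₛₗ[(σ : R →+* R)] (R ⧸ m), Function.Bijective e ∧
      ∀ x, e (Submodule.Quotient.mk x) = Submodule.Quotient.mk (σ x) := by
  have : RingHomSurjective (σ : R →+* R) := ⟨σ.surjective⟩
  exact exists_bijective_quotient (σ : R →+* R).toSemilinearMap σ.surjective rfl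

theorem isMaximal_comap (σ : R ≃+* R) {m : Ideal R} (hm : m.IsMaximal) :
    (m.comap (σ : R →+* R)).IsMaximal := by
  have : RingHomSurjective (σ : R →+* R) := ⟨σ.surjective⟩
  obtain ⟨e, he, -⟩ := exists_bijective_quotient_comap σ m
  rw [Ideal.isMaximal_def, ← isSimpleModule_iff_isCoatom] at hm ⊢
  exact (LinearMap.isSimpleModule_iff_of_bijective e he).2 hm

/-- The action of a ring automorphism on the isomorphism classes of simple modules. -/
def simpleClassEquiv (σ : R ≃+* R) : Quotient (simpleSetoid R) ≃ Quotient (simpleSetoid R) :=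
  Quotient.congr
    { toFun := fun m => ⟨m.1.comap (σ : R →+* R), isMaximal_comap σ m.2⟩
      invFun := fun m => ⟨m.1.comap (σ.symm : R →+* R), isMaximal_comap σ.symm m.2⟩
      left_inv := fun m => Subtype.ext <| SetLike.ext fun x => by
        change σ (σ.symm x) ∈ m.1 ↔ _
        rw [σ.apply_symm_apply]
      right_inv := fun m => Subtype.ext <| SetLike.ext fun x => by
        change σ.symm (σ x) ∈ m.1 ↔ _
        rw [σ.symm_apply_apply] }
    fun m m' => by
      obtain ⟨e, he, -⟩ := exists_bijective_quotient_comap σ m.1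
      obtain ⟨e', he', -⟩ := exists_bijective_quotient_comap σ m'.1
      exact (nonempty_linearEquiv_iff (f := (σ : R →+* R)) σ.surjective e he e' he').symm

theorem classTrace_simpleClassEquiv (σ : R ≃ₐ[k] R) (c : Quotient (simpleSetoid R)) (x : R) :
    classTrace k (simpleClassEquiv σ.toRingEquiv c) x = classTrace k c (σ x) := by
  induction c using Quotient.inductionOn with
  | _ m =>
    obtain ⟨e, he, hmk⟩ := exists_bijective_quotient_comap σ.toRingEquiv m.1
    let e' := (AddEquiv.ofBijective e.toAddMonoidHom he)
    have he' : ∀ y, e' y = e y := fun y => rfl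
    refine actionTrace_congr (e'.toLinearEquiv fun r y => ?_) x (σ x) fun y => e.map_smulₛₗ x y
    rw [← algebraMap_smul R r y, ← algebraMap_smul R r (e' y), he', he', e.map_smulₛₗ]
    congr 1
    exact σ.commutes r

/-- Twisting by σ permutes the isomorphism classes of simple modules, so it only reorders the sum of
traces. -/
theorem simpleTrace_algEquiv [Finite R] (σ : R ≃ₐ[k] R) (x : R) :
    simpleTrace k R (σ x) = simpleTrace k R x := by
  have := Fintype.ofFinite (Quotient (simpleSetoid R))
  rw [simpleTrace_apply, simpleTrace_apply]
  conv_rhs => rw [← Equiv.sum_comp (simpleClassEquiv σ.toRingEquiv)]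
  exact Finset.sum_congr rfl fun c _ => (classTrace_simpleClassEquiv σ c x).symm

/-- Extensions of finite fields are separable, so their trace is surjective. Finiteness of the base
field enters for this reason. -/
theorem exists_trace_mulRight_ne_zero_of_field (k D : Type*) [Field k] [Field D] [Finite D]
    [Algebra k D] : ∃ d : D, LinearMap.trace k D (LinearMap.mulRight k d) ≠ 0 := by
  have : Finite k := Finite.of_injective _ (algebraMap k D).injective
  have : Module.Finite k D := Module.Finite.of_finite
  obtain ⟨d, hd⟩ := Algebra.trace_surjective k D 1
  refine ⟨d, ?_⟩
  have h : LinearMap.mulRight k d = Algebra.lmul k D d := LinearMap.ext fun e => mul_comm e d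
  rw [h, ← Algebra.trace_apply]
  rw [hd]
  exact one_ne_zero

theorem exists_trace_mulRight_ne_zero (k D : Type*) [Field k] [DivisionRing D] [Finite D]
    [Algebra k D] : ∃ d : D, LinearMap.trace k D (LinearMap.mulRight k d) ≠ 0 :=
  @exists_trace_mulRight_ne_zero_of_field k D _ (littleWedderburn D) _ _

/-- If `x` does not annihilate a finite simple module `E`, there is an endomorphism `f` of `E` over
`End E` such that `w ↦ f (x • w)` has nonzero trace. -/
theorem exists_linearMap_trace_ne_zero {E : Type*} [AddCommGroup E] [Module k E] [Module R E]
    [IsScalarTower k R E] [Finite E] [IsSimpleModule R E] {x : R} {v : E} (hv : x • v ≠ 0) :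
    ∃ (f : E →ₗ[Module.End R E] E) (T : E →ₗ[k] E), (∀ w, T w = f (x • w)) ∧
      LinearMap.trace k E T ≠ 0 := by
  classical
  have : Finite (Module.End R E) := Finite.of_injective (fun φ => (φ : E → E)) DFunLike.coe_injective
  obtain ⟨d, hd⟩ := exists_trace_mulRight_ne_zero k (Module.End R E)
  -- With D = End E, choose a D-linear φ : E → D with φ(xv) = d and put f(w) = φ(w)v. Cyclicity of
  -- the trace moves the computation to D, where g ↦ φ(x · gv) = gd has nonzero trace.
  obtain ⟨φ, -, hφ⟩ := LinearMap.exists_extend_of_notMem (K := Module.End R E)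
    (p := (⊥ : Submodule (Module.End R E) E)) (v := x • v) 0 (fun h => hv h) d
  have : IsScalarTower k (Module.End R E) E := ⟨fun r g w => rfl⟩
  let s : Module.End R E →ₗ[k] E := (LinearMap.toSpanSingleton _ E v).restrictScalars k
  let ψ : E →ₗ[k] Module.End R E := φ.restrictScalars k ∘ₗ (Algebra.lsmul k k E x)
  have : Module.Finite k (Module.End R E) := Module.Finite.of_finite
  have : Module.Finite k E := Module.Finite.of_finite
  refine ⟨(LinearMap.toSpanSingleton _ E v) ∘ₗ φ, s ∘ₗ ψ, fun w => rfl, ?_⟩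
  rw [LinearMap.trace_comp_comm']
  have h : ψ ∘ₗ s = LinearMap.mulRight k d := by
    refine LinearMap.ext fun g => ?_
    change φ (x • g v) = g * d
    rw [← hφ, ← map_smul g, ← smul_eq_mul, ← map_smul φ]
    rfl
  rwa [h]

/-- The radical of the trace form of `simpleTrace` is contained in the Jacobson radical. -/
theorem exists_simpleTrace_ne_zero [Finite R] {x : R} (hx : x ∉ Ring.jacobson R) :
    ∃ y, simpleTrace k R (y * x) ≠ 0 := by
  classical
  have := Fintype.ofFinite (Quotient (simpleSetoid R))
  obtain ⟨m, hm, hxm⟩ : ∃ m : Ideal R, m.IsMaximal ∧ x ∉ m := by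
    rw [Ring.jacobson_eq_sInf_isMaximal, Submodule.mem_sInf] at hx
    push Not at hx
    exact hx
  let E : Quotient (simpleSetoid R) → Type _ := fun c => R ⧸ c.out.1
  have hE : ∀ c, IsSimpleModule R (E c) := fun c => isSimpleModule_iff_isCoatom.2 c.out.2.out
  have hfin : ∀ c, Finite (E c) := fun c =>
    Finite.of_surjective _ (Submodule.mkQ_surjective c.out.1)
  have htr : ∀ c y, classTrace k c y = actionTrace k R (E c) y := fun c y => by
    conv_lhs => rw [← c.out_eq]
    rfl
  have hschur : ∀ c c', c ≠ c' → ∀ g : E c →ₗ[R] E c', g = 0 := by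
    intro c c' hc g
    rcases g.bijective_or_eq_zero with h | h
    · exact absurd (Quotient.out_equiv_out.1 (Nonempty.intro (LinearEquiv.ofBijective g h))) hc
    · exact h
  let c₀ : Quotient (simpleSetoid R) := Quotient.mk _ ⟨m, hm⟩
  obtain ⟨v, hv⟩ : ∃ v : E c₀, x • v ≠ 0 := by
    obtain ⟨e⟩ : Nonempty (E c₀ ≃ₗ[R] (R ⧸ m)) := Quotient.mk_out (s := simpleSetoid R) ⟨m, hm⟩
    refine ⟨e.symm (Submodule.Quotient.mk 1), fun h => hxm ?_⟩
    rw [← map_smul, LinearEquiv.map_eq_zero_iff, ← Submodule.Quotient.mk_smul,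
      Submodule.Quotient.mk_eq_zero, smul_eq_mul, mul_one] at h
    exact h
  obtain ⟨f, T, hT, hf⟩ := exists_linearMap_trace_ne_zero (k := k) hv
  -- By Schur, endomorphisms of this product of pairwise nonisomorphic simples are diagonal. Hence f
  -- on the factor c₀ and 0 elsewhere commutes with them, and density provides y acting in this way.
  -- Only c₀ then contributes to the trace of yx.
  let V := ∀ c, E c
  have hcomm : ∀ (g : Module.End R V) (w : V),
      (Pi.single c₀ (f (g w c₀)) : V) = g (Pi.single c₀ (f (w c₀))) := by
    intro g w
    let g₀ : Module.End R (E c₀) :=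
      LinearMap.proj c₀ ∘ₗ g ∘ₗ LinearMap.single R E c₀
    have h1 : g w c₀ = g₀ (w c₀) := by
      conv_lhs => rw [← Finset.univ_sum_single w, map_sum, Finset.sum_apply]
      refine Finset.sum_eq_single c₀ (fun c _ hc => ?_) (fun h => absurd (Finset.mem_univ _) h)
      exact LinearMap.congr_fun (hschur c c₀ hc
        (LinearMap.proj c₀ ∘ₗ g ∘ₗ LinearMap.single R E c)) (w c)
    rw [h1]
    have h2 : f (g₀ (w c₀)) = g₀ (f (w c₀)) := f.map_smul g₀ (w c₀)
    rw [h2]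
    funext c
    by_cases hc : c = c₀
    · subst hc
      rw [Pi.single_eq_same]
      rfl
    · rw [Pi.single_eq_of_ne hc]
      exact (LinearMap.congr_fun (hschur c₀ c (Ne.symm hc)
        (LinearMap.proj c ∘ₗ g ∘ₗ LinearMap.single R E c₀)) (f (w c₀))).symm
  let Φ : Module.End (Module.End R V) V :=
    { toFun := fun w => Pi.single c₀ (f (w c₀))
      map_add' := fun a b => by rw [Pi.add_apply, map_add, Pi.single_add]
      map_smul' := hcomm }
  have : Fintype V := Fintype.ofFinite V
  obtain ⟨y, hy⟩ := jacobson_density (R := R) Φ Finset.univ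
  have hy' : ∀ w : V, (Pi.single c₀ (f (w c₀)) : V) = y • w := fun w => hy w (Finset.mem_univ w)
  refine ⟨y, ?_⟩
  rw [simpleTrace_apply, Finset.sum_eq_single c₀]
  · have h : Algebra.lsmul k k (E c₀) (y * x) = T := LinearMap.ext fun w => by
      have := congrFun (hy' (Pi.single c₀ (x • w))) c₀
      rw [Pi.single_eq_same, Pi.smul_apply, Pi.single_eq_same] at this
      rw [hT, this]
      exact mul_smul y x w
    rwa [htr, actionTrace_apply, h]
  · intro c _ hc
    have h : Algebra.lsmul k k (E c) (y * x) = 0 := LinearMap.ext fun w => by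
      have := congrFun (hy' (Pi.single c (x • w))) c
      rw [Pi.single_eq_of_ne hc, Pi.smul_apply, Pi.single_eq_same] at this
      exact (mul_smul y x w).trans this.symm
    rw [htr, actionTrace_apply, h, map_zero]
  · exact fun h => absurd (Finset.mem_univ _) h

end SimpleTrace

end CartanDecomp

/-! ### From the finite prime field to F -/

namespace CartanDecomp

section BaseChange

open MonoidAlgebra

variable {F N : Type*} [Field F] [Group N]

/-- The linear extension of a function on a group to the group algebra. -/
noncomputable def linExt (θ : N → F) : MonoidAlgebra F N →ₗ[F] F :=
  (MonoidAlgebra.basis N F).constr F θ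

@[simp]
theorem linExt_single (θ : N → F) (n : N) (c : F) : linExt θ (single n c) = c * θ n := by
  have h : single n c = c • MonoidAlgebra.basis N F n := by simp
  rw [h, map_smul, linExt, Module.Basis.constr_basis, smul_eq_mul]

variable (k : Type*) [Field k] [Algebra k F]

/-- The function on the group given by the sum of the traces on the simple modules over `k`, with
values in an extension field. -/
noncomputable def simpleCharacter (F N : Type*) [Field F] [Group N] [Algebra k F] (n : N) : F :=
  algebraMap k F (simpleTrace k (MonoidAlgebra k N) (of k N n))

/-- The extended functional is the trace of the matrix representation of F[N] obtained from M by
extending scalars, and nilpotent matrices have trace 0. -/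
theorem linExt_actionTrace_eq_zero (M : Type*) [AddCommGroup M] [Module k M] [Module.Finite k M]
    [Module (MonoidAlgebra k N) M] [IsScalarTower k (MonoidAlgebra k N) M]
    {b : MonoidAlgebra F N} (hb : IsNilpotent b) :
    linExt (fun n => algebraMap k F (actionTrace k (MonoidAlgebra k N) M (of k N n))) b = 0 := by
  let B := Module.finBasis k M
  let d := Fin (Module.finrank k M)
  let ρ : MonoidAlgebra k N →ₐ[k] Matrix d d k :=
    (LinearMap.toMatrixAlgEquiv B).toAlgHom.comp (Algebra.lsmul k k M)
  let ρF : MonoidAlgebra F N →ₐ[F] Matrix d d F :=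
    MonoidAlgebra.lift F (Matrix d d F) N
      (((algebraMap k F).mapMatrix : Matrix d d k →+* Matrix d d F).toMonoidHom.comp
        ((ρ : MonoidAlgebra k N →* Matrix d d k).comp (of k N)))
  have h : ∀ x, linExt (fun n => algebraMap k F (actionTrace k (MonoidAlgebra k N) M (of k N n))) x
      = Matrix.trace (ρF x) := by
    intro x
    induction x using MonoidAlgebra.induction_linear with
    | zero => simp
    | add x y hx hy => rw [map_add, map_add, hx, hy, Matrix.trace_add]
    | single n c =>
      have h1 : ρF (single n c) = c • (ρ (of k N n)).map (algebraMap k F) := by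
        rw [MonoidAlgebra.lift_single]
        rfl
      rw [linExt_single, h1, Matrix.trace_smul, smul_eq_mul, actionTrace_apply,
        LinearMap.trace_eq_matrix_trace k B]
      congr 1
      exact (AddMonoidHom.map_trace (algebraMap k F).toAddMonoidHom _)
  rw [h]
  exact (Matrix.isNilpotent_trace_of_isNilpotent (hb.map ρF)).eq_zero

variable [Finite N]

theorem isNilpotent_of_mem_jacobson {R : Type*} [Ring R] [IsArtinianRing R] {x : R}
    (hx : x ∈ Ring.jacobson R) : IsNilpotent x := by
  obtain ⟨n, hn⟩ := IsArtinianRing.isNilpotent_jacobson_bot (R := R)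
  rw [Ideal.jacobson_bot] at hn
  exact ⟨n, by simpa [hn] using Ideal.pow_mem_pow hx n⟩

instance : IsArtinianRing (MonoidAlgebra F N) :=
  have : Module.Finite F (MonoidAlgebra F N) := Module.Finite.of_basis (MonoidAlgebra.basis N F)
  IsArtinianRing.of_finite F _

/-- The Jacobson radical of the group algebra over the small field is mapped into the Jacobson
radical over the large field. -/
theorem mapRingHom_mem_jacobson {b : MonoidAlgebra k N}
    (hb : b ∈ Ring.jacobson (MonoidAlgebra k N)) :
    mapRingHom N (algebraMap k F) b ∈ Ring.jacobson (MonoidAlgebra F N) := by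
  set τ := mapRingHom N (algebraMap k F)
  set J := Ring.jacobson (MonoidAlgebra k N)
  rw [Ring.jacobson_eq_sInf_isMaximal, Submodule.mem_sInf]
  intro m hm
  have hE : IsSimpleModule (MonoidAlgebra F N) (MonoidAlgebra F N ⧸ m) :=
    isSimpleModule_iff_isCoatom.2 (Ideal.isMaximal_def.1 hm)
  have := IsSimpleModule.nontrivial (MonoidAlgebra F N) (MonoidAlgebra F N ⧸ m)
  -- The vectors killed by J(k[N]) form an F[N]-submodule because J(k[N]) is two-sided and F is
  -- central. If it were 0, nonzero vectors would survive every power of the nilpotent ideal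
  -- J(k[N]).
  let U : Submodule (MonoidAlgebra F N) (MonoidAlgebra F N ⧸ m) :=
    { carrier := {v | ∀ b ∈ J, τ b • v = 0}
      add_mem' := fun hu hv b hb => by rw [smul_add, hu b hb, hv b hb, add_zero]
      zero_mem' := fun b _ => smul_zero _
      smul_mem' := fun c v hv => by
        induction c using MonoidAlgebra.induction_linear with
        | zero => intro b _; simp
        | add x y hx hy => intro b hb; rw [add_smul, smul_add, hx b hb, hy b hb, add_zero]
        | single n c =>
          intro b hb
          have h1 : single n c = algebraMap F (MonoidAlgebra F N) c * τ (of k N n) := by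
            simp [τ, single_mul_single]
          rw [smul_smul, h1, ← mul_assoc, ← Algebra.commutes, mul_assoc, ← map_mul, mul_smul,
            hv _ (Ideal.IsTwoSided.mul_mem_of_left _ hb), smul_zero] }
  rcases eq_bot_or_eq_top U with hU | hU
  · exfalso
    obtain ⟨r, hr⟩ := IsArtinianRing.isNilpotent_jacobson_bot (R := MonoidAlgebra k N)
    rw [Ideal.jacobson_bot] at hr
    obtain ⟨v, hv⟩ := exists_ne (0 : MonoidAlgebra F N ⧸ m)
    have key : ∀ n : ℕ, ∃ b ∈ J ^ n, τ b • v ≠ 0 := by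
      intro n
      induction n with
      | zero => exact ⟨1, by rw [Submodule.pow_zero, Ideal.one_eq_top]; trivial, by simpa using hv⟩
      | succ n ih =>
        obtain ⟨b, hb, hbv⟩ := ih
        have : τ b • v ∉ U := fun h => hbv (by rwa [hU, Submodule.mem_bot] at h)
        change ¬ ∀ b' ∈ J, τ b' • τ b • v = 0 at this
        push Not at this
        obtain ⟨b', hb', h⟩ := this
        refine ⟨b' * b, ?_, by rwa [map_mul, mul_smul]⟩
        rw [Ideal.IsTwoSided.pow_succ]
        exact Ideal.mul_mem_mul hb' hb
    obtain ⟨b, hb, hbv⟩ := key r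
    rw [hr] at hb
    rw [(Submodule.mem_bot _).1 hb, map_zero, zero_smul] at hbv
    exact hbv rfl
  · have h : (Submodule.Quotient.mk 1 : MonoidAlgebra F N ⧸ m) ∈ U := hU ▸ Submodule.mem_top
    have h' := h b hb
    rwa [← Submodule.Quotient.mk_smul, Submodule.Quotient.mk_eq_zero, smul_eq_mul, mul_one] at h'

variable [Finite k]

instance : Finite (MonoidAlgebra k N) :=
  Finite.of_injective (fun x => (x.coeff : N → k))
    (DFunLike.coe_injective.comp MonoidAlgebra.coeff_injective)

theorem linExt_simpleCharacter_eq_zero {b : MonoidAlgebra F N} (hb : IsNilpotent b) :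
    linExt (simpleCharacter k F N) b = 0 := by
  have := Fintype.ofFinite (Quotient (simpleSetoid (MonoidAlgebra k N)))
  have h : linExt (simpleCharacter k F N) = ∑ c : Quotient (simpleSetoid (MonoidAlgebra k N)),
      linExt (fun n => algebraMap k F (classTrace k c (of k N n))) := by
    refine LinearMap.ext fun x => ?_
    induction x using MonoidAlgebra.induction_linear with
    | zero => simp
    | add x y hx hy => rw [map_add, map_add, hx, hy]
    | single n c =>
      rw [LinearMap.sum_apply, linExt_single, simpleCharacter, simpleTrace_apply, map_sum,
        Finset.mul_sum]
      simp
  rw [h, LinearMap.sum_apply]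
  refine Finset.sum_eq_zero fun c _ => ?_
  induction c using Quotient.inductionOn with
  | _ m =>
    have : Finite (MonoidAlgebra k N ⧸ m.1) :=
      Finite.of_surjective _ (Submodule.mkQ_surjective m.1)
    have : Module.Finite k (MonoidAlgebra k N ⧸ m.1) := Module.Finite.of_finite
    exact linExt_actionTrace_eq_zero k (MonoidAlgebra k N ⧸ m.1) hb

theorem linExt_simpleCharacter_mul_eq_zero {b : MonoidAlgebra F N}
    (hb : b ∈ Ring.jacobson (MonoidAlgebra F N)) (y : MonoidAlgebra F N) :
    linExt (simpleCharacter k F N) (y * b) = 0 :=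
  linExt_simpleCharacter_eq_zero k (isNilpotent_of_mem_jacobson (Ideal.mul_mem_left _ y hb))

/-- Expand b in a k-basis of F. Since χ takes values in k, the hypothesis holds for each component
in k[N], which therefore lies in J(k[N]); and J(k[N]) maps into J(F[N]). -/
theorem mem_jacobson_of_linExt_eq_zero {b : MonoidAlgebra F N}
    (hb : ∀ n, linExt (simpleCharacter k F N) (of F N n * b) = 0) :
    b ∈ Ring.jacobson (MonoidAlgebra F N) := by
  let e := Module.Basis.ofVectorSpace k F
  let part : ∀ i, MonoidAlgebra F N → MonoidAlgebra k N := fun i x =>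
    MonoidAlgebra.map (e.coord i).toAddMonoidHom x
  have hpart : ∀ i (y : MonoidAlgebra k N) (x : MonoidAlgebra F N),
      simpleTrace k _ (y * part i x) =
        e.coord i (linExt (simpleCharacter k F N) (mapRingHom N (algebraMap k F) y * x)) := by
    intro i y x
    induction x using MonoidAlgebra.induction_linear with
    | zero => simp [part]
    | add x x' hx hx' =>
      simp only [part] at hx hx' ⊢
      rw [MonoidAlgebra.map_add, mul_add, mul_add, map_add, map_add, map_add, hx, hx']
    | single n c =>
      induction y using MonoidAlgebra.induction_linear with
      | zero => simp
      | add y y' hy hy' => rw [add_mul, map_add, map_add, add_mul, map_add, map_add, hy, hy']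
      | single n' c' =>
        have h1 : ∀ d : k, single (n' * n) d = d • of k N (n' * n) := fun d => by simp
        simp only [part, MonoidAlgebra.map_single, mapRingHom_single, single_mul_single,
          linExt_single, simpleCharacter]
        rw [h1, map_smul, mul_assoc, mul_comm c, ← mul_assoc, ← map_mul, ← Algebra.smul_def,
          map_smul, smul_eq_mul, smul_eq_mul]
        change (c' * e.coord i c) * _ = _
        ring
  have hb' : ∀ y : MonoidAlgebra k N,
      linExt (simpleCharacter k F N) (mapRingHom N (algebraMap k F) y * b) = 0 := by
    intro y
    induction y using MonoidAlgebra.induction_linear with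
    | zero => simp
    | add y y' hy hy' => rw [map_add, add_mul, map_add, hy, hy', add_zero]
    | single n c =>
      have h1 : mapRingHom N (algebraMap k F) (single n c) = algebraMap k F c • of F N n := by
        rw [mapRingHom_single, of_apply, smul_single, smul_eq_mul, mul_one]
      rw [h1, smul_mul_assoc, map_smul, hb, smul_zero]
  have hmem : ∀ i, part i b ∈ Ring.jacobson (MonoidAlgebra k N) := by
    intro i
    by_contra h
    obtain ⟨y, hy⟩ := exists_simpleTrace_ne_zero (k := k) h
    rw [hpart, hb', map_zero] at hy
    exact hy rfl
  classical
  have := Fintype.ofFinite N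
  let s := Finset.univ.biUnion fun n => (e.repr (b.coeff n)).support
  have hsum : b = ∑ i ∈ s, e i • mapRingHom N (algebraMap k F) (part i b) := by
    ext n
    rw [coeff_sum, Finset.sum_apply']
    conv_lhs => rw [← e.linearCombination_repr (b.coeff n), Finsupp.linearCombination_apply]
    rw [Finsupp.sum_of_support_subset (s := s) _
      (Finset.subset_biUnion_of_mem (fun n => (e.repr (b.coeff n)).support) (Finset.mem_univ n))
      (fun i a => a • e i) (fun i _ => zero_smul _ _)]
    refine Finset.sum_congr rfl fun i _ => ?_
    rw [Algebra.smul_def, mul_comm]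
    rfl
  rw [hsum]
  refine sum_mem fun i _ => ?_
  rw [Algebra.smul_def]
  exact Ideal.mul_mem_left _ _ (mapRingHom_mem_jacobson k (hmem i))

theorem simpleCharacter_mulEquiv (σ : N ≃* N) (n : N) :
    simpleCharacter k F N (σ n) = simpleCharacter k F N n := by
  have h : of k N (σ n) = MonoidAlgebra.domCongr k k σ (of k N n) := by simp
  rw [simpleCharacter, simpleCharacter, h, simpleTrace_algEquiv]

end BaseChange

end CartanDecomp

/-! ### Decomposition of F[G] along the cosets of N -/

namespace CartanDecomp

section Slices

open MonoidAlgebra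

variable {F G : Type*} [Field F] [Group G] (N : Subgroup G)

/-- The part of an element of `F[G]` supported on the coset `g N`, moved to `F[N]`. -/
noncomputable def slice (a : MonoidAlgebra F G) (g : G) : MonoidAlgebra F N :=
  comapDomain (fun n : N => g * n) ((mul_right_injective g).comp Subtype.val_injective) a

@[simp]
theorem slice_coeff (a : MonoidAlgebra F G) (g : G) (n : N) :
    (slice N a g).coeff n = a.coeff (g * n) := by
  simp [slice]

theorem slice_mul_inv (a : MonoidAlgebra F G) (g : G) (n : N) :
    slice N a (g * (n : G)⁻¹) = of F N n * slice N a g := by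
  ext m
  rw [of_apply, coeff_single_mul_apply, slice_coeff, slice_coeff, one_mul]
  simp [mul_assoc]

theorem incl_coeff (b : MonoidAlgebra F N) (n : N) : (incl F N b).coeff n = b.coeff n :=
  Finsupp.mapDomain_apply Subtype.val_injective b.coeff n

theorem incl_coeff_of_notMem (b : MonoidAlgebra F N) {g : G} (hg : g ∉ N) :
    (incl F N b).coeff g = 0 :=
  Finsupp.mapDomain_of_notMem_range b.coeff g (by simpa using hg)

/-- An element is the sum of its slices. -/
theorem sum_slice [Fintype (G ⧸ N)] (a : MonoidAlgebra F G) :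
    a = ∑ q : G ⧸ N, of F G q.out * incl F N (slice N a q.out) := by
  ext h
  rw [coeff_sum, Finset.sum_apply', Finset.sum_eq_single (h : G ⧸ N)]
  · have hmem : (h : G ⧸ N).out⁻¹ * h ∈ N := QuotientGroup.eq.1 (QuotientGroup.out_eq' _)
    rw [of_apply, coeff_single_mul_apply, one_mul, incl_coeff N _ ⟨_, hmem⟩, slice_coeff,
      mul_inv_cancel_left]
  · intro q _ hq
    rw [of_apply, coeff_single_mul_apply, one_mul]
    refine incl_coeff_of_notMem N _ fun hmem => hq ?_
    rw [← QuotientGroup.eq.2 hmem, QuotientGroup.out_eq']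
  · exact fun h => absurd (Finset.mem_univ _) h

theorem mem_of_slice_mem [Finite G] {I : Ideal (MonoidAlgebra F G)} {a : MonoidAlgebra F G}
    (h : ∀ g, incl F N (slice N a g) ∈ I) : a ∈ I := by
  have := Fintype.ofFinite (G ⧸ N)
  rw [sum_slice N a]
  exact sum_mem fun q _ => I.mul_mem_left _ (h _)

end Slices

/-! ### The central element z, its annihilator and the ideal it generates -/

section CentralElement

open MonoidAlgebra

variable (k : Type*) {F G : Type*} [Field k] [Field F] [Algebra k F] [Group G] [Finite G]
  (N : Subgroup G)

open Classical in
/-- The element of `F[N]` that represents the sum of the simple characters over `k`, with respect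
to the standard symmetrizing form. -/
noncomputable def socleElement (F : Type*) [Field F] [Algebra k F] : MonoidAlgebra F G :=
  ofCoeff (Finsupp.equivFunOnFinite.symm fun g =>
    if h : g⁻¹ ∈ N then simpleCharacter k F N ⟨g⁻¹, h⟩ else 0)

open Classical in
theorem socleElement_coeff (g : G) : (socleElement k N F).coeff g =
    if h : g⁻¹ ∈ N then simpleCharacter k F N ⟨g⁻¹, h⟩ else 0 := rfl

/-- The inverse in the definition of z is made for this: z(h⁻¹g) = χ(g⁻¹h) is nonzero only for h =
gn with n ∈ N, so the convolution is the sum of a(gn)χ(n). -/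
theorem mul_socleElement_coeff (a : MonoidAlgebra F G) (g : G) :
    (a * socleElement k N F).coeff g = linExt (simpleCharacter k F N) (slice N a g) := by
  induction a using MonoidAlgebra.induction_linear with
  | zero =>
    have : slice N (0 : MonoidAlgebra F G) g = 0 := by ext; simp
    simp [this]
  | add x y hx hy =>
    have : slice N (x + y) g = slice N x g + slice N y g := by ext; simp
    rw [add_mul, coeff_add, Finsupp.add_apply, hx, hy, this, map_add]
  | single h c =>
    rw [coeff_single_mul_apply, socleElement_coeff]
    have hinv : (h⁻¹ * g)⁻¹ = g⁻¹ * h := by group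
    split_ifs with hm
    · have : slice N (single h c) g = single ⟨(h⁻¹ * g)⁻¹, hm⟩ c := by
        classical
        ext n
        rw [slice_coeff, coeff_single, coeff_single, Finsupp.single_apply, Finsupp.single_apply]
        congr 1
        rw [Subtype.ext_iff, eq_iff_iff]
        change h = g * n ↔ (h⁻¹ * g)⁻¹ = n
        rw [hinv, inv_mul_eq_iff_eq_mul]
      rw [this, linExt_single]
    · have : slice N (single h c) g = 0 := by
        classical
        ext n
        rw [slice_coeff, coeff_single, Finsupp.single_apply, if_neg, coeff_zero, Finsupp.zero_apply]
        rintro rfl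
        apply hm
        simp
      rw [this, map_zero, mul_zero]

variable [Finite k]

/-- Replacing g by gn⁻¹ multiplies the slice by n on the left. Vanishing of all coefficients thus
says that each slice lies in the radical of the form χ(uv). -/
theorem mul_socleElement_eq_zero_iff_slice (a : MonoidAlgebra F G) :
    a * socleElement k N F = 0 ↔
      ∀ g, slice N a g ∈ Ring.jacobson (MonoidAlgebra F N) := by
  constructor
  · intro h g
    refine mem_jacobson_of_linExt_eq_zero k fun n => ?_
    rw [← slice_mul_inv, ← mul_socleElement_coeff, h]
    simp
  · intro h
    ext g
    have := linExt_simpleCharacter_mul_eq_zero k (h g) 1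
    rw [one_mul] at this
    rw [mul_socleElement_coeff, this]
    simp

theorem incl_mul_socleElement {b : MonoidAlgebra F N}
    (hb : b ∈ Ring.jacobson (MonoidAlgebra F N)) : incl F N b * socleElement k N F = 0 := by
  rw [mul_socleElement_eq_zero_iff_slice]
  intro g
  by_cases hg : g ∈ N
  · have : slice N (incl F N b) g = of F N ⟨g, hg⟩⁻¹ * b := by
      ext n
      rw [slice_coeff, of_apply, coeff_single_mul_apply, inv_inv, one_mul]
      exact incl_coeff N b (⟨g, hg⟩ * n)
    rw [this]
    exact Ideal.mul_mem_left _ _ hb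
  · have : slice N (incl F N b) g = 0 := by
      ext n
      rw [slice_coeff, incl_coeff_of_notMem]
      · simp
      · rwa [Subgroup.mul_mem_cancel_right _ n.2]
    rw [this]
    exact zero_mem _

theorem mul_socleElement_eq_zero_iff (a : MonoidAlgebra F G) :
    a * socleElement k N F = 0 ↔ a ∈ idealJ F N := by
  constructor
  · intro h
    rw [mul_socleElement_eq_zero_iff_slice] at h
    exact mem_of_slice_mem N fun g => Ideal.subset_span ⟨_, h g, rfl⟩
  · intro h
    refine Submodule.span_induction (p := fun x _ => x * socleElement k N F = 0) ?_ ?_ ?_ ?_ h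
    · rintro _ ⟨b, hb, rfl⟩
      exact incl_mul_socleElement k N hb
    · exact zero_mul _
    · intro x y _ _ hx hy
      rw [add_mul, hx, hy, add_zero]
    · intro c x _ hx
      rw [smul_eq_mul, mul_assoc, hx, mul_zero]

theorem socleElement_commute [N.Normal] (a : MonoidAlgebra F G) :
    a * socleElement k N F = socleElement k N F * a := by
  induction a using MonoidAlgebra.induction_linear with
  | zero => simp
  | add x y hx hy => rw [add_mul, mul_add, hx, hy]
  | single g c =>
    ext h
    rw [coeff_single_mul_apply, coeff_mul_single_apply, mul_comm c]
    congr 1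
    rw [socleElement_coeff, socleElement_coeff]
    have e : (g⁻¹ * h)⁻¹ = g⁻¹ * (h * g⁻¹)⁻¹ * (g⁻¹)⁻¹ := by group
    by_cases hm : (h * g⁻¹)⁻¹ ∈ N
    · have hm' : (g⁻¹ * h)⁻¹ ∈ N := e ▸ Subgroup.Normal.conj_mem ‹_› _ hm _
      rw [dif_pos hm, dif_pos hm']
      have := simpleCharacter_mulEquiv (F := F) k (MulAut.conjNormal g⁻¹ : N ≃* N) ⟨_, hm⟩
      rw [← this]
      congr 1
      exact Subtype.ext e
    · rw [dif_neg hm, dif_neg]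
      intro hm'
      apply hm
      have := Subgroup.Normal.conj_mem ‹_› _ hm' g
      rw [e] at this
      convert! this using 1
      group

/-- Double annihilator argument for the symmetrizing form "coefficient at 1": an element outside zA
is separated from zA by a functional x ↦ (wx)(1). Vanishing on zA means wz = 0, so w ∈ AJ and wa =
0, contradicting separation. -/
theorem mem_annJ_iff [N.Normal] (a : MonoidAlgebra F G) :
    a ∈ annJ F N ↔ ∃ b, a = socleElement k N F * b := by
  constructor
  · intro ha
    by_contra hne
    let W : Submodule F (MonoidAlgebra F G) :=
      LinearMap.range (LinearMap.mulLeft F (socleElement k N F))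
    have haW : a ∉ W := fun ⟨b, hb⟩ => hne ⟨b, hb.symm⟩
    obtain ⟨φ, hφa, hφW⟩ := Submodule.exists_dual_map_eq_bot_of_notMem haW inferInstance
    let w : MonoidAlgebra F G :=
      ofCoeff (Finsupp.equivFunOnFinite.symm fun g => φ (of F G g⁻¹))
    have hw : ∀ x, (w * x).coeff 1 = φ x := by
      intro x
      induction x using MonoidAlgebra.induction_linear with
      | zero => simp
      | add x y hx hy => rw [mul_add, coeff_add, Finsupp.add_apply, hx, hy, map_add]
      | single g c =>
        have : single g c = c • of F G g := by simp
        rw [coeff_mul_single_apply, this, map_smul, smul_eq_mul, mul_comm c]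
        congr 1
        change φ (of F G (1 * g⁻¹)⁻¹) = _
        simp
    have hwz : w * socleElement k N F = 0 := by
      ext h
      have h1 : (w * socleElement k N F).coeff h =
          (w * (socleElement k N F * of F G h⁻¹)).coeff 1 := by
        rw [← mul_assoc, of_apply, coeff_mul_single_apply]
        simp
      rw [h1, hw]
      have : φ (socleElement k N F * of F G h⁻¹) ∈ W.map φ := ⟨_, ⟨_, rfl⟩, rfl⟩
      rw [hφW, Submodule.mem_bot] at this
      rw [this]
      simp
    rw [mul_socleElement_eq_zero_iff] at hwz
    have hwa : w * a = 0 := by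
      refine Submodule.span_induction (p := fun x _ => x * a = 0) ?_ ?_ ?_ ?_ hwz
      · rintro _ ⟨b, hb, rfl⟩
        exact ha b hb
      · exact zero_mul _
      · intro x y _ _ hx hy
        rw [add_mul, hx, hy, add_zero]
      · intro c x _ hx
        rw [smul_eq_mul, mul_assoc, hx, mul_zero]
    apply hφa
    rw [← hw, hwa]
    simp
  · rintro ⟨b, rfl⟩ β hβ
    rw [← mul_assoc, incl_mul_socleElement k N hβ, zero_mul]

end CentralElement

end CartanDecomp

/-! ### One-sided identities modulo an ideal -/

namespace CartanDecomp

section Identities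

open MulOpposite

/-- Modulo the Jacobson radical, a left ideal of an Artinian ring has a right identity. -/
theorem exists_right_identity {R : Type*} [Ring R] [IsArtinianRing R] (K : Ideal R) :
    ∃ ε ∈ K, ∀ x ∈ K, x * ε - x ∈ Ring.jacobson R := by
  let π := Ideal.Quotient.mk (Ring.jacobson R)
  have hπ : Function.Surjective π := Ideal.Quotient.mk_surjective
  obtain ⟨e, he, hK⟩ := IsSemisimpleRing.ideal_eq_span_idempotent (K.map π)
  have heK : e ∈ K.map π := hK ▸ Ideal.mem_span_singleton_self e
  obtain ⟨ε, hε, rfl⟩ := (Ideal.mem_map_iff_of_surjective π hπ).1 heK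
  refine ⟨ε, hε, fun x hx => ?_⟩
  have hx' := Ideal.mem_map_of_mem π hx
  rw [hK, Ideal.mem_span_singleton'] at hx'
  obtain ⟨r, hr⟩ := hx'
  rw [← Ideal.Quotient.eq]
  change π (x * ε) = π x
  rw [map_mul, ← hr, mul_assoc, he]

/-- Modulo the Jacobson radical, a two-sided ideal of an Artinian ring has a left identity. -/
theorem exists_left_identity {R : Type*} [Ring R] [IsArtinianRing R] (K : Ideal R)
    [K.IsTwoSided] : ∃ ε ∈ K, ∀ x ∈ K, ε * x - x ∈ Ring.jacobson R := by
  let π := Ideal.Quotient.mk (Ring.jacobson R)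
  have hπ : Function.Surjective π := Ideal.Quotient.mk_surjective
  -- The image of K is taken as a left ideal of the opposite ring, where its idempotent generator
  -- becomes a left identity.
  let L : Ideal (R ⧸ Ring.jacobson R)ᵐᵒᵖ :=
    { carrier := {s | ∃ x ∈ K, op (π x) = s}
      add_mem' := by
        rintro _ _ ⟨x, hx, rfl⟩ ⟨y, hy, rfl⟩
        exact ⟨x + y, add_mem hx hy, by rw [map_add, op_add]⟩
      zero_mem' := ⟨0, zero_mem _, by rw [map_zero, op_zero]⟩
      smul_mem' := by
        rintro c _ ⟨x, hx, rfl⟩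
        obtain ⟨r, hr⟩ := hπ c.unop
        exact ⟨x * r, K.mul_mem_right _ hx, by rw [map_mul, op_mul, hr, op_unop, smul_eq_mul]⟩ }
  obtain ⟨e, he, hL⟩ := IsSemisimpleRing.ideal_eq_span_idempotent L
  obtain ⟨ε, hε, rfl⟩ : e ∈ L := hL ▸ Ideal.mem_span_singleton_self e
  refine ⟨ε, hε, fun x hx => ?_⟩
  have hx' : op (π x) ∈ L := ⟨x, hx, rfl⟩
  rw [hL, Ideal.mem_span_singleton'] at hx'
  obtain ⟨r, hr⟩ := hx'
  rw [← Ideal.Quotient.eq]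
  change π (ε * x) = π x
  apply op_injective
  rw [map_mul, op_mul, ← hr, mul_assoc, he]

variable {A : Type*} [Ring A] {P : Type*} [AddCommGroup P] [Module Aᵐᵒᵖ P]

theorem rightSMul_mono {K L : Set A} (h : L ⊆ K) : rightSMul L P ≤ rightSMul K P :=
  Submodule.span_mono fun _ ⟨k, hk, x, hx⟩ => ⟨k, h hk, x, hx⟩

/-- Let V consist of the x with xK ⊆ PL. Since (x - xε)k = x(k - εk) ∈ PL, every x lies in PK + V;
as P is hollow and PK ≠ P, V is all of P. -/
theorem rightSMul_eq_of_left_identity (hP : IsHollow Aᵐᵒᵖ P) {K L : Ideal A} (hLK : L ≤ K)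
    {ε : A} (hε : ε ∈ K) (h : ∀ x ∈ K, ε * x - x ∈ L) (hK : rightSMul (K : Set A) P ≠ ⊤) :
    rightSMul (K : Set A) P = rightSMul (L : Set A) P := by
  refine le_antisymm ?_ (rightSMul_mono hLK)
  let V : Submodule Aᵐᵒᵖ P :=
    { carrier := {x | ∀ k ∈ K, op k • x ∈ rightSMul (L : Set A) P}
      add_mem' := fun hx hy k hk => by rw [smul_add]; exact add_mem (hx k hk) (hy k hk)
      zero_mem' := fun k _ => by rw [smul_zero]; exact zero_mem _
      smul_mem' := fun a x hx k hk => by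
        rw [smul_smul, ← op_unop a, ← op_mul]
        exact hx _ (K.mul_mem_left _ hk) }
  have hV : V = ⊤ := by
    refine (hP (rightSMul (K : Set A) P) V ?_).resolve_left hK
    rw [eq_top_iff]
    intro x _
    refine Submodule.mem_sup.2 ⟨op ε • x, op_smul_mem_rightSMul hε x, x - op ε • x, ?_, by abel⟩
    intro k hk
    rw [smul_sub, smul_smul, ← op_mul, ← sub_smul, ← op_sub]
    exact op_smul_mem_rightSMul (by simpa using L.neg_mem (h k hk)) x
  refine Submodule.span_le.2 ?_
  rintro _ ⟨k, hk, x, rfl⟩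
  exact (hV ▸ Submodule.mem_top : x ∈ V) k hk

theorem op_smul_sub_mem_of_right_identity {K L : Ideal A} [K.IsTwoSided]
    {ε : A} (h : ∀ x ∈ K, x * ε - x ∈ L) (hK : rightSMul (K : Set A) P = ⊤) (x : P) :
    op ε • x - x ∈ rightSMul (L : Set A) P := by
  -- The case a = 1 is not visibly stable under scalars, so the induction over the span carries an
  -- arbitrary a.
  have key : ∀ a : A, op ε • op a • x - op a • x ∈ rightSMul (L : Set A) P := by
    refine Submodule.span_induction (R := Aᵐᵒᵖ) (p := fun x _ => ∀ a : A,
      op ε • op a • x - op a • x ∈ rightSMul (L : Set A) P) ?_ ?_ ?_ ?_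
      (hK ▸ Submodule.mem_top : x ∈ rightSMul (K : Set A) P)
    · rintro _ ⟨k, hk, y, rfl⟩ a
      rw [smul_smul (op a), ← op_mul, smul_smul, ← op_mul, ← sub_smul, ← op_sub]
      exact op_smul_mem_rightSMul (h _ (K.mul_mem_right _ hk)) y
    · intro a
      rw [smul_zero, smul_zero, sub_zero]
      exact zero_mem _
    · intro y z _ _ hy hz a
      have := add_mem (hy a) (hz a)
      rwa [sub_add_sub_comm, ← smul_add, ← smul_add] at this
    · intro b y _ hy a
      rw [smul_smul (op a), ← op_unop b, ← op_mul]
      exact hy _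
  simpa using key 1

/-- If `P K = P` and `K` has a right identity modulo `L`, no composition factor of `P / P L` is
annihilated by `K`. -/
theorem compMultiplicity_eq_zero_of_right_identity {K L : Ideal A} [K.IsTwoSided]
    {ε : A} (hε : ε ∈ K) (h : ∀ x ∈ K, x * ε - x ∈ L) (hK : rightSMul (K : Set A) P = ⊤)
    {E : Type*} [AddCommGroup E] [Module Aᵐᵒᵖ E] (hE : ∀ k ∈ K, ∀ x : E, op k • x = 0) :
    compMultiplicity Aᵐᵒᵖ (P ⧸ rightSMul (L : Set A) P) E = 0 := by
  by_contra hne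
  obtain ⟨a, b, hab, ⟨g⟩⟩ := exists_of_compMultiplicity_ne_zero hne
  refine hab.lt.not_ge fun y hy => ?_
  have h1 : op ε • y = y := by
    induction y using Submodule.Quotient.induction_on with
    | _ x =>
      rw [← Submodule.Quotient.mk_smul, Submodule.Quotient.eq]
      exact op_smul_sub_mem_of_right_identity h hK x
  have h2 : op ε • (Submodule.Quotient.mk ⟨y, hy⟩ : b ⧸ a.comap b.subtype) = 0 := by
    apply g.injective
    rw [map_smul, hE ε hε, map_zero]
  rw [← Submodule.Quotient.mk_smul, Submodule.Quotient.mk_eq_zero, Submodule.mem_comap] at h2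
  change op ε • y ∈ a at h2
  rwa [h1] at h2

end Identities

/-! ### Augmentation ideal of F[N], kernel of F[G] → F[G/N], and P / PJ ≅ PI -/

section GroupAlgebra

open MonoidAlgebra MulOpposite

variable {F G : Type*} [Field F] [Group G] (N : Subgroup G)

/-- The augmentation of the group algebra. -/
noncomputable def augmentation (F N : Type*) [Field F] [Group N] : MonoidAlgebra F N →ₐ[F] F :=
  MonoidAlgebra.lift F F N 1

theorem augmentation_single {N : Type*} [Group N] (n : N) (c : F) :
    augmentation F N (single n c) = c := by
  simp [augmentation]

variable {N} in
theorem incl_single (n : N) (c : F) : incl F N (single n c) = single (n : G) c :=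
  mapDomain_single

theorem proj_single [N.Normal] (g : G) (c : F) : proj F N (single g c) = single (g : G ⧸ N) c :=
  mapDomain_single

theorem proj_incl [N.Normal] (b : MonoidAlgebra F N) :
    proj F N (incl F N b) = algebraMap F _ (augmentation F N b) := by
  induction b using MonoidAlgebra.induction_linear with
  | zero => simp
  | add x y hx hy => simp only [map_add, hx, hy]
  | single n c =>
    rw [incl_single, proj_single, augmentation_single, (QuotientGroup.eq_one_iff (n : G)).2 n.2]
    simp

theorem augmentation_slice [N.Normal] (a : MonoidAlgebra F G) (g : G) :
    augmentation F N (slice N a g) = (proj F N a).coeff g := by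
  classical
  induction a using MonoidAlgebra.induction_linear with
  | zero =>
    have : slice N (0 : MonoidAlgebra F G) g = 0 := by ext; simp
    simp [this]
  | add x y hx hy =>
    have : slice N (x + y) g = slice N x g + slice N y g := by ext; simp
    rw [this, map_add, map_add, hx, hy]
    rfl
  | single h c =>
    rw [proj_single, coeff_single, Finsupp.single_apply]
    split_ifs with hgh
    · have hm : g⁻¹ * h ∈ N := QuotientGroup.eq.1 hgh.symm
      have : slice N (single h c) g = single ⟨g⁻¹ * h, hm⟩ c := by
        ext n
        rw [slice_coeff, coeff_single, coeff_single, Finsupp.single_apply, Finsupp.single_apply]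
        congr 1
        rw [Subtype.ext_iff, eq_iff_iff]
        exact inv_mul_eq_iff_eq_mul.symm
      rw [this, augmentation_single]
    · have : slice N (single h c) g = 0 := by
        ext n
        rw [slice_coeff, coeff_single, Finsupp.single_apply, if_neg, coeff_zero, Finsupp.zero_apply]
        rintro rfl
        apply hgh
        rw [eq_comm, QuotientGroup.eq]
        simp
      rw [this, map_zero]

theorem exists_conj_augmentation [N.Normal] (g : G) (b : MonoidAlgebra F N) :
    ∃ c, augmentation F N c = augmentation F N b ∧
      of F G g * incl F N b = incl F N c * of F G g := by
  refine ⟨MonoidAlgebra.domCongr F F (MulAut.conjNormal g : N ≃* N) b, ?_, ?_⟩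
  all_goals
    induction b using MonoidAlgebra.induction_linear with
    | zero => simp
    | add x y hx hy => simp only [map_add, mul_add, add_mul, hx, hy]
    | single n c => simp [augmentation_single, single_mul_single]

theorem incl_mem_idealJ {b : MonoidAlgebra F N}
    (hb : b ∈ Ring.jacobson (MonoidAlgebra F N)) : incl F N b ∈ idealJ F N :=
  Ideal.subset_span ⟨b, hb, rfl⟩

variable [Finite G]

theorem augmentation_eq_zero_of_mem_jacobson {b : MonoidAlgebra F N}
    (hb : b ∈ Ring.jacobson (MonoidAlgebra F N)) : augmentation F N b = 0 :=
  ((isNilpotent_of_mem_jacobson hb).map (augmentation F N)).eq_zero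

variable [N.Normal]

theorem idealJ_le_ker_proj : idealJ F N ≤ RingHom.ker (proj F N) := by
  refine Ideal.span_le.2 ?_
  rintro _ ⟨b, hb, rfl⟩
  rw [SetLike.mem_coe, RingHom.mem_ker, proj_incl, augmentation_eq_zero_of_mem_jacobson N hb,
    map_zero]

/-- An element of the kernel has all its slices in the augmentation ideal of F[N]. As the slices
stand to the right of the coset representatives, a right identity there works termwise. -/
theorem exists_right_identity_ker_proj :
    ∃ ε ∈ RingHom.ker (proj F N), ∀ x ∈ RingHom.ker (proj F N), x * ε - x ∈ idealJ F N := by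
  obtain ⟨ε, hε, h⟩ := exists_right_identity (RingHom.ker (augmentation F N))
  refine ⟨incl F N ε, ?_, fun x hx => ?_⟩
  · rw [RingHom.mem_ker, proj_incl, (RingHom.mem_ker).1 hε, map_zero]
  · have := Fintype.ofFinite (G ⧸ N)
    rw [sum_slice N x, Finset.sum_mul, ← Finset.sum_sub_distrib]
    refine sum_mem fun q _ => ?_
    rw [mul_assoc, ← map_mul, ← mul_sub, ← map_sub]
    refine Ideal.mul_mem_left _ _ (incl_mem_idealJ N (h _ ?_))
    rw [RingHom.mem_ker, augmentation_slice, (RingHom.mem_ker).1 hx]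
    rfl

theorem exists_left_identity_ker_proj :
    ∃ ε ∈ RingHom.ker (proj F N), ∀ x ∈ RingHom.ker (proj F N), ε * x - x ∈ idealJ F N := by
  obtain ⟨ε, hε, h⟩ := exists_left_identity (RingHom.ker (augmentation F N))
  refine ⟨incl F N ε, ?_, fun x hx => ?_⟩
  · rw [RingHom.mem_ker, proj_incl, (RingHom.mem_ker).1 hε, map_zero]
  · have := Fintype.ofFinite (G ⧸ N)
    rw [sum_slice N x, Finset.mul_sum, ← Finset.sum_sub_distrib]
    refine sum_mem fun q _ => ?_
    -- To apply a left identity the slice must be moved across its coset representative; conjugation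
    -- preserves the augmentation.
    obtain ⟨c, hc, hcomm⟩ := exists_conj_augmentation N q.out (slice N x q.out)
    rw [hcomm, ← mul_assoc, ← map_mul, ← sub_mul, ← map_sub]
    refine Ideal.mul_mem_right _ _ (incl_mem_idealJ N (h _ ?_))
    rw [RingHom.mem_ker, hc, augmentation_slice, (RingHom.mem_ker).1 hx]
    rfl

section Action

variable {P : Type*} [AddCommGroup P] [Module (MonoidAlgebra F G)ᵐᵒᵖ P]

/-- A right module on which `N` acts trivially is annihilated by the kernel of
`F[G] → F[G/N]`. -/
theorem op_smul_eq_zero_of_mem_ker_proj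
    (hP : ∀ n ∈ N, ∀ x : P, op (of F G n) • x = x) {a : MonoidAlgebra F G}
    (ha : a ∈ RingHom.ker (proj F N)) (x : P) : op a • x = 0 := by
  have key : ∀ (b : MonoidAlgebra F N) (x : P),
      op (incl F N b) • x = op (algebraMap F (MonoidAlgebra F G) (augmentation F N b)) • x := by
    intro b x
    induction b using MonoidAlgebra.induction_linear with
    | zero => simp
    | add y z hy hz => rw [map_add, map_add, map_add, op_add, op_add, add_smul, add_smul, hy, hz]
    | single n c =>
      have : single (n : G) c = algebraMap F (MonoidAlgebra F G) c * of F G n := by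
        simp [single_mul_single]
      rw [incl_single, augmentation_single, this, op_mul, mul_smul, hP n n.2]
  have := Fintype.ofFinite (G ⧸ N)
  rw [sum_slice N a, Finset.op_sum, Finset.sum_smul]
  refine Finset.sum_eq_zero fun q _ => ?_
  rw [op_mul, mul_smul, key, augmentation_slice, (RingHom.mem_ker).1 ha]
  simp

instance : IsArtinianRing (MonoidAlgebra F G)ᵐᵒᵖ :=
  have : Module.Finite F (MonoidAlgebra F G) := Module.Finite.of_basis (MonoidAlgebra.basis G F)
  have : Module.Finite F (MonoidAlgebra F G)ᵐᵒᵖ := Module.Finite.equiv (opLinearEquiv F)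
  IsArtinianRing.of_finite F _

/-- Since P is hollow, PK ≠ P already gives PK ≤ rad P, that is, K kills the head. -/
theorem headIsQuotientModule_iff (hP : IsPIM (MonoidAlgebra F G) P) :
    HeadIsQuotientModule F N P ↔
      rightSMul (RingHom.ker (proj F N) : Set (MonoidAlgebra F G)) P ≠ ⊤ := by
  constructor
  · intro h htop
    refine hP.jacobson_ne_top (eq_top_iff.2 (htop ▸ Submodule.span_le.2 ?_))
    rintro _ ⟨k, hk, x, rfl⟩
    rw [SetLike.mem_coe, ← Submodule.Quotient.mk_eq_zero, Submodule.Quotient.mk_smul]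
    exact op_smul_eq_zero_of_mem_ker_proj N h hk _
  · intro h n hn x
    induction x using Submodule.Quotient.induction_on with
    | _ x =>
      rw [← Submodule.Quotient.mk_smul, Submodule.Quotient.eq]
      have hk : of F G n - 1 ∈ RingHom.ker (proj F N) := by
        rw [RingHom.mem_ker, map_sub, map_one, of_apply, proj_single,
          (QuotientGroup.eq_one_iff n).2 hn, one_def, sub_self]
      have := hP.isHollow.le_jacobson h (op_smul_mem_rightSMul hk x)
      rwa [op_sub, sub_smul, op_one, one_smul] at this

/-- For a principal indecomposable module `P`, multiplication by the socle element induces an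
isomorphism of `P / P J` with `P I`. -/
theorem compMultiplicity_annJ (p : ℕ) [Fact p.Prime] [CharP F p]
    (hP : IsPIM (MonoidAlgebra F G) P) (E : Type*) [AddCommGroup E]
    [Module (MonoidAlgebra F G)ᵐᵒᵖ E] :
    compMultiplicity (MonoidAlgebra F G)ᵐᵒᵖ
        (rightSMul (annJ F N : Set (MonoidAlgebra F G)) P) E =
      compMultiplicity (MonoidAlgebra F G)ᵐᵒᵖ
        (P ⧸ rightSMul (idealJ F N : Set (MonoidAlgebra F G)) P) E := by
  have := hP.finite
  obtain ⟨-, i, q, h⟩ := hP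
  let _ : Algebra (ZMod p) F := ZMod.algebra F p
  let z := socleElement (ZMod p) N F
  let m : P →ₗ[(MonoidAlgebra F G)ᵐᵒᵖ] P :=
    { toFun := fun x => op z • x
      map_add' := smul_add _
      map_smul' := fun a x => by
        rw [RingHom.id_apply, smul_smul, smul_smul, ← op_unop a, ← op_mul, ← op_mul,
          socleElement_commute] }
  -- The embedding i reduces this to A: xz = 0 gives i(x)z = 0, so i(x) ∈ AJ, and x = (q 1) · i(x).
  have hker : LinearMap.ker m = rightSMul (idealJ F N : Set (MonoidAlgebra F G)) P := by
    apply le_antisymm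
    · intro x hx
      have hx' : op z • x = 0 := hx
      have h1 : i x * z = 0 := by
        rw [← op_smul_eq_mul, ← map_smul, hx', map_zero]
      rw [← op_smul_map_one h x]
      exact op_smul_mem_rightSMul ((mul_socleElement_eq_zero_iff _ N _).1 h1) _
    · refine Submodule.span_le.2 ?_
      rintro _ ⟨k, hk, x, rfl⟩
      change op z • op k • x = 0
      rw [smul_smul, ← op_mul, (mul_socleElement_eq_zero_iff _ N _).2 hk, op_zero, zero_smul]
  have hrange : LinearMap.range m = rightSMul (annJ F N : Set (MonoidAlgebra F G)) P := by
    apply le_antisymm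
    · rintro _ ⟨x, rfl⟩
      exact op_smul_mem_rightSMul ((mem_annJ_iff (ZMod p) N z).2 ⟨1, (mul_one z).symm⟩) x
    · refine Submodule.span_le.2 ?_
      rintro _ ⟨k, hk, x, rfl⟩
      obtain ⟨b, rfl⟩ := (mem_annJ_iff (ZMod p) N k).1 hk
      refine ⟨op b • x, ?_⟩
      rw [map_smul]
      change op b • op z • x = _
      rw [smul_smul, ← op_mul]
  rw [← hker, ← hrange]
  exact (compMultiplicity_congr (m.quotKerEquivRange : _ →ₗ[(MonoidAlgebra F G)ᵐᵒᵖ] _)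
    m.quotKerEquivRange.bijective (LinearMap.id : E →ₗ[(MonoidAlgebra F G)ᵐᵒᵖ] E)
    Function.bijective_id).symm

end Action

end GroupAlgebra

end CartanDecomp

/-! ### Assembly of the Cartan numbers -/

namespace CartanDecomp

/-- The Cartan matrix is the sum of those of the quotients by `F[G]J` and by its annihilator. -/
theorem cartanMatrix_eq_add {F : Type*} [Field F] (p : ℕ) [Fact p.Prime] [CharP F p]
    {G : Type*} [Group G] [Finite G] (N : Subgroup G) [N.Normal]
    {ι : Type*} (P : ι → Type*) [∀ i, AddCommGroup (P i)]
    [∀ i, Module (MonoidAlgebra F G)ᵐᵒᵖ (P i)]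
    (hP : ∀ i, IsPIM (MonoidAlgebra F G) (P i)) (i j : ι) :
    cartanMatrix (MonoidAlgebra F G) P i j =
      quotientCartanMatrix (Ideal.Quotient.mk (idealJ F N)) P i j +
        quotientCartanMatrix (Ideal.Quotient.mk (annJ F N)) P i j := by
  have := (hP i).finite
  rw [quotientCartanMatrix_apply _ Ideal.Quotient.mk_surjective P hP,
    quotientCartanMatrix_apply _ Ideal.Quotient.mk_surjective P hP, Ideal.mk_ker, Ideal.mk_ker,
    ← compMultiplicity_annJ N p (hP i)]
  exact compMultiplicity_add_quotient _ _

end CartanDecomp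

open CartanDecomp

theorem theorem5p3 {F : Type*} [Field F] (p : ℕ) [Fact p.Prime] [CharP F p]
    {G : Type*} [Group G] [Finite G] (N : Subgroup G) [N.Normal]
    (hF : CartanDecomp.IsSplittingFieldFor F G)
    {ι : Type*} (P : ι → Type*) [∀ i, AddCommGroup (P i)]
    [∀ i, Module (MonoidAlgebra F G)ᵐᵒᵖ (P i)]
    (hP : ∀ i, CartanDecomp.IsPIM (MonoidAlgebra F G) (P i))
    (c cbar x a : Matrix ι ι ℕ)
    (hc : c = CartanDecomp.cartanMatrix (MonoidAlgebra F G) P)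
    (hcbar : cbar = CartanDecomp.quotientCartanMatrix (CartanDecomp.proj F N) P)
    (hx : x = CartanDecomp.quotientCartanMatrix (Ideal.Quotient.mk (CartanDecomp.annJ F N)) P)
    (ha : a = CartanDecomp.quotientCartanMatrix (Ideal.Quotient.mk (CartanDecomp.idealJ F N)) P)
    (S₁ S₂ : Set ι)
    (hS₁ : S₁ = {i | CartanDecomp.HeadIsQuotientModule F N (P i)})
    (hS₂ : S₂ = {i | ¬ CartanDecomp.HeadIsQuotientModule F N (P i)}) :
    (∀ i ∈ S₁, ∀ j ∈ S₁, c i j = cbar i j + x i j) ∧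
    (∀ i ∈ S₂, ∀ j ∈ S₁, c i j = x i j) ∧
    (∀ i ∈ S₂, ∀ j ∈ S₂, c i j = a i j + x i j) := by
  subst hc hcbar hx ha hS₁ hS₂
  have hproj : Function.Surjective (proj F N) := by
    intro b
    induction b using MonoidAlgebra.induction_linear with
    | zero => exact ⟨0, map_zero _⟩
    | add y z hy hz =>
      obtain ⟨y', rfl⟩ := hy
      obtain ⟨z', rfl⟩ := hz
      exact ⟨y' + z', map_add _ _ _⟩
    | single q c =>
      obtain ⟨g, rfl⟩ := QuotientGroup.mk_surjective q
      exact ⟨MonoidAlgebra.single g c, proj_single N g c⟩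
  refine ⟨fun i hi j _ => ?_, fun i hi j hj => ?_, fun i _ j _ => cartanMatrix_eq_add p N P hP i j⟩
  -- Here P_iK ≠ P_i, so P_iK = P_iJ and the summand a_ij equals cbar_ij.
  · obtain ⟨ε, hε, h⟩ := exists_left_identity_ker_proj (F := F) N
    rw [cartanMatrix_eq_add p N P hP, quotientCartanMatrix_apply _ hproj P hP,
      rightSMul_eq_of_left_identity (hP i).isHollow (idealJ_le_ker_proj N) hε h
        ((headIsQuotientModule_iff N (hP i)).1 hi),
      quotientCartanMatrix_apply _ Ideal.Quotient.mk_surjective P hP, Ideal.mk_ker]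
  -- Here P_iK = P_i while K kills Hd(P_j), so the summand a_ij vanishes.
  · obtain ⟨ε, hε, h⟩ := exists_right_identity_ker_proj (F := F) N
    rw [cartanMatrix_eq_add p N P hP,
      quotientCartanMatrix_apply (Ideal.Quotient.mk (idealJ F N)) Ideal.Quotient.mk_surjective P hP,
      Ideal.mk_ker, compMultiplicity_eq_zero_of_right_identity hε h
        (not_not.1 fun hK => hi ((headIsQuotientModule_iff N (hP i)).2 hK))
        fun k hk y => op_smul_eq_zero_of_mem_ker_proj N hj hk y, zero_add]
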